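/- Let $\alpha\in(0,1)$, let $c = 1/\sum_{k\ge 0} e^{-k^\alpha}$, and let $X_1,X_2,\ldots$ be i.i.d. $\mathbb N_0$-valued random variables with $\mathbb P(X_i=k)=c\,e^{-k^\alpha}$ for $k\in\mathbb N_0$, with expected value $\mu$ and variance $\sigma^2$. Put $S_n=X_1+\cdots+X_n$, $M_n=\max(X_1,\ldots,X_n)$ and $\gamma=1/(2-\alpha)$. For $s\in\mathbb R$ and a decreasing sequence $x_1\ge x_2\ge\cdots$ in $\mathbb R_+=[0,\infty)$ let \[ F_s(x_1,x_2,\ldots)=\sum_{j\ge1}x_j^\alpha+\frac1{2\sigma^2}\Bigl(s-\sum_{j\ge1}x_j\Bigr)^2\in[0,\infty], \] and for $y\in\mathbb R_+$ let $f_s(y)$ be the infimum of $F_s$ over all decreasing sequences in $\mathbb R_+$ with $x_1=y$. Then $f_s(y)\in[0,\infty)$, and for all $s\in\mathbb R$ and $y\ge0$, \[ f_s(y)=y^\alpha+\inf_{z\in[0,y]}f_{s-y}(z). \] Let $(s_n)_{n\ge1}$ be a real sequence with $s_n\to s\in\mathbb R$ and $\mu n+s_nn^\gamma\in\mathbb N_0$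 for all $n\ge 1$, and let $Q_n$ be the distribution of $M_n/n^\gamma$ under $\mathbb P(\,\cdot\mid S_n=\mu n+s_nn^\gamma)$. Then $(Q_n)$ satisfies the large deviation principle on $\mathbb R_+$ with speed $n^{\gamma\alpha}$ and good rate function $I_s=f_s-\inf_{\mathbb R_+}f_s$; that is, $I_s\ge0$ is lower semicontinuous with compact sublevel sets, for every closed $A\subset\mathbb R_+$ \[ \limsup_{n\to\infty}\frac1{n^{\gamma\alpha}}\log Q_n(A)\le-\inf_{A}I_s, \] and for every open (relative to $\mathbb R_+$) set $O\subset\mathbb R_+$ \[ \liminf_{n\to\infty}\frac1{n^{\gamma\alpha}}\log Q_n(O)\ge-\inf_{O}I_s, \] with $\log 0=-\infty$ and $\inf_\varnothing I_s=+\infty$. -/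

import Mathlib

open MeasureTheory ProbabilityTheory Filter Topology
open scoped NNReal ENNReal

noncomputable section

namespace StretchedExp

/-- The normalizing constant `c = 1 / ∑_{k ≥ 0} exp (-k^α)`. -/
def normConst (α : ℝ) : ℝ := 1 / ∑' k : ℕ, Real.exp (-(k : ℝ) ^ α)

/-- The family `X` consists of i.i.d. `ℕ`-valued random variables with the stretched exponential
law `P (X i = k) = c exp (-k^α)`. -/
structure IsIIDStretchedExp {Ω : Type*} [MeasurableSpace Ω] (P : Measure Ω) (α : ℝ)
    (X : ℕ → Ω → ℕ) : Prop where
  measurable : ∀ i, Measurable (X i)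
  indep : iIndepFun X P
  law : ∀ i k, P {ω | X i ω = k} = ENNReal.ofReal (normConst α * Real.exp (-(k : ℝ) ^ α))

/-- The partial sum of the first `n` variables. -/
def partialSum {Ω : Type*} (X : ℕ → Ω → ℕ) (n : ℕ) (ω : Ω) : ℕ := ∑ i ∈ Finset.range n, X i ω

/-- The maximum of the first `n` variables (it is `0` if `n = 0`). -/
def partialMax {Ω : Type*} (X : ℕ → Ω → ℕ) (n : ℕ) (ω : Ω) : ℕ :=
  (Finset.range n).sup fun i => X i ω

/-- The law of `M_n / n^γ` on `[0, ∞)` under the conditional law `P (· | S_n = a)`. -/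
def condMaxLaw {Ω : Type*} [MeasurableSpace Ω] (P : Measure Ω) (X : ℕ → Ω → ℕ) (γ : ℝ) (n : ℕ)
    (a : ℝ) : Measure ℝ≥0 :=
  (ProbabilityTheory.cond P {ω | (partialSum X n ω : ℝ) = a}).map
    fun ω => (partialMax X n ω : ℝ≥0) / (n : ℝ≥0) ^ γ

/-- `F_s(x) = ∑ x_j^α + (s - ∑ x_j)^2 / (2 σ²)`, with values in `[0, ∞]`. The sums are taken in
`[0, ∞]`; if `∑ x_j = ∞` then the square is `∞`. -/
def F (α σ2 s : ℝ) (x : ℕ → ℝ≥0) : EReal :=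
  ((∑' j, ((x j ^ α : ℝ≥0) : ℝ≥0∞) : ℝ≥0∞) : EReal) +
    ((1 / (2 * σ2) : ℝ) : EReal) * ((s : EReal) - ((∑' j, (x j : ℝ≥0∞) : ℝ≥0∞) : EReal)) ^ 2

/-- `f_s(y)`, the infimum of `F_s` over decreasing sequences in `[0, ∞)` whose first term
is `y`. -/
def f (α σ2 s : ℝ) (y : ℝ≥0) : EReal :=
  ⨅ x ∈ {x : ℕ → ℝ≥0 | Antitone x ∧ x 0 = y}, F α σ2 s x

/-- A good rate function: nonnegative, lower semicontinuous, with compact sublevel sets. -/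
structure IsGoodRateFunction {E : Type*} [TopologicalSpace E] (I : E → EReal) : Prop where
  nonneg : ∀ x, 0 ≤ I x
  lowerSemicontinuous : LowerSemicontinuous I
  isCompact_sublevel : ∀ c : ℝ, IsCompact {x | I x ≤ (c : EReal)}

/-- The large deviation principle with speed `a n` and rate function `I`
(here `log 0 = -∞` and the infimum over the empty set is `+∞`). -/
structure SatisfiesLDP {E : Type*} [TopologicalSpace E] [MeasurableSpace E]
    (Q : ℕ → Measure E) (a : ℕ → ℝ) (I : E → EReal) : Prop where
  upper : ∀ A : Set E, IsClosed A →
    limsup (fun n => ENNReal.log (Q n A) / (a n : EReal)) atTop ≤ -⨅ y ∈ A, I y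
  lower : ∀ O : Set E, IsOpen O →
    -⨅ y ∈ O, I y ≤ liminf (fun n => ENNReal.log (Q n O) / (a n : EReal)) atTop

end StretchedExp

end

/-!
Write `γ = 1 / (2 - α)`. The theorem follows from
`P (S_n = μ n + s_n n^γ, M_n / n^γ ∈ A) ≈ exp (-n^(γ α) inf_A f_s)` after dividing by the case
`A = [0, ∞)`.

For the upper bound, give every variable the weight `exp (λ (X_i - μ))` while it is below `ε n^γ`
and `exp ((1 - η) X_i ^ α)` once it is above. Since `λ` is of order `n^(γ α - γ)`, the product of
the weights has mean about `exp (n σ² λ² / 2)`, and Markov's inequality applies. Finitely many `λ`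
suffice to recover the quadratic `t² / (2 σ²)` as a Legendre transform, and the entries above
`ε n^γ`, divided by `n^γ`, form a competitor in the variational problem which defines `f_s`.

For the lower bound, take a nearly optimal finite sequence `x_0 ≥ ⋯ ≥ x_k` with `x_0 = y` and
prescribe the last `k + 2` variables: the jumps `⌊x_j n^γ⌋` and one correction which makes the sum
exact. The other variables only have to come close to the remaining deviation of order `n^γ`, and
the same exponential weights, killed above `ε n^γ`, show that they do so at the quadratic cost.
-/

noncomputable section

namespace StretchedExp

/-! ### The rate function -/

section RateFunction

variable {α σ2 s : ℝ}

lemma ereal_sq_nonneg (u : EReal) : 0 ≤ u ^ 2 := by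
  rw [pow_two]
  rcases le_total 0 u with hu | hu
  · exact mul_nonneg hu hu
  · exact EReal.mul_nonneg_iff.2 (.inr ⟨hu, hu⟩)

lemma F_nonneg (hσ : 0 < σ2) (s : ℝ) (x : ℕ → ℝ≥0) : 0 ≤ F α σ2 s x :=
  add_nonneg (EReal.coe_ennreal_nonneg _)
    (mul_nonneg (EReal.coe_nonneg.2 (by positivity)) (ereal_sq_nonneg _))

lemma F_eq_coe_of_summable {x : ℕ → ℝ≥0} (hpow : Summable fun j => x j ^ α) (hx : Summable x) :
    F α σ2 s x =
      ((∑' j, (x j : ℝ) ^ α + 1 / (2 * σ2) * (s - ∑' j, (x j : ℝ)) ^ 2 : ℝ) : EReal) := by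
  unfold F
  rw [← ENNReal.coe_tsum hpow, ← ENNReal.coe_tsum hx]
  simp only [← NNReal.coe_rpow, ← NNReal.coe_tsum, EReal.coe_add, EReal.coe_mul, EReal.coe_pow,
    EReal.coe_sub]
  rfl

lemma summable_rpow_of_F_lt_top (hσ : 0 < σ2) {x : ℕ → ℝ≥0} (h : F α σ2 s x < ⊤) :
    Summable fun j => x j ^ α := by
  rw [← ENNReal.tsum_coe_ne_top_iff_summable]
  intro htop
  refine h.ne ?_
  rw [F, htop, EReal.coe_ennreal_top, EReal.top_add_of_ne_bot]
  refine (EReal.bot_lt_zero.trans_le ?_).ne'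
  exact mul_nonneg (EReal.coe_nonneg.2 (by positivity)) (ereal_sq_nonneg _)

lemma summable_of_F_lt_top (hσ : 0 < σ2) {x : ℕ → ℝ≥0} (h : F α σ2 s x < ⊤) : Summable x := by
  rw [← ENNReal.tsum_coe_ne_top_iff_summable]
  intro htop
  have hsq : ((s : EReal) - ((⊤ : ℝ≥0∞) : EReal)) ^ 2 = ⊤ := by
    rw [EReal.coe_ennreal_top, EReal.sub_top, pow_two, EReal.bot_mul_bot]
  refine h.ne ?_
  rw [F, htop, hsq, EReal.mul_top_of_pos (EReal.coe_pos.2 (by positivity)),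
    EReal.add_top_of_ne_bot]
  exact (EReal.bot_lt_zero.trans_le (EReal.coe_ennreal_nonneg _)).ne'

lemma F_eq_rpow_add_F_tail (α σ2 s : ℝ) (x : ℕ → ℝ≥0) :
    F α σ2 s x = (((x 0 : ℝ) ^ α : ℝ) : EReal) + F α σ2 (s - x 0) fun j => x (j + 1) := by
  unfold F
  rw [tsum_eq_zero_add' (f := fun j => ((x j ^ α : ℝ≥0) : ℝ≥0∞)) ENNReal.summable,
    tsum_eq_zero_add' (f := fun j => ((x j : ℝ≥0) : ℝ≥0∞)) ENNReal.summable,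
    EReal.coe_ennreal_add, EReal.coe_ennreal_add, add_assoc]
  congr 1
  congr 3
  rw [sub_eq_add_neg, sub_eq_add_neg, EReal.neg_add (.inl (by simp)) (.inl (by simp)),
    EReal.coe_sub, sub_eq_add_neg, sub_eq_add_neg, add_assoc]
  rfl

lemma f_nonneg (hσ : 0 < σ2) (s : ℝ) (y : ℝ≥0) : 0 ≤ f α σ2 s y :=
  le_iInf₂ fun x _ => F_nonneg hσ s x

lemma f_le_rpow_add_f (s : ℝ) {y z : ℝ≥0} (hzy : z ≤ y) :
    f α σ2 s y ≤ (((y : ℝ) ^ α : ℝ) : EReal) + f α σ2 (s - y) z := by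
  rw [add_comm, ← EReal.sub_le_iff_le_add (by simp) (by simp)]
  refine le_iInf₂ fun x hx => ?_
  rw [EReal.sub_le_iff_le_add (by simp) (by simp), add_comm]
  let yx : ℕ → ℝ≥0 := fun j => Nat.casesOn j y x
  have hyx : Antitone yx := antitone_nat_of_succ_le fun
    | 0 => hx.2.le.trans hzy
    | j + 1 => hx.1 (Nat.le_succ j)
  exact (iInf₂_le yx ⟨hyx, rfl⟩).trans (F_eq_rpow_add_F_tail α σ2 s yx).le

lemma f_eq_rpow_add_iInf (s : ℝ) (y : ℝ≥0) :
    f α σ2 s y = (((y : ℝ) ^ α : ℝ) : EReal) + ⨅ z ∈ Set.Icc 0 y, f α σ2 (s - y) z := by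
  apply le_antisymm
  · rw [add_comm, ← EReal.sub_le_iff_le_add (by simp) (by simp)]
    refine le_iInf₂ fun z hz => ?_
    rw [EReal.sub_le_iff_le_add (by simp) (by simp), add_comm]
    exact f_le_rpow_add_f s hz.2
  · refine le_iInf₂ fun x hx => ?_
    rw [F_eq_rpow_add_F_tail, hx.2]
    refine add_le_add le_rfl ?_
    refine (iInf₂_le (x 1) ⟨zero_le, hx.2 ▸ hx.1 zero_le_one⟩).trans ?_
    exact iInf₂_le _ ⟨fun i j hij => hx.1 (Nat.succ_le_succ hij), rfl⟩

lemma rpow_le_f (hσ : 0 < σ2) (s : ℝ) (y : ℝ≥0) : (((y : ℝ) ^ α : ℝ) : EReal) ≤ f α σ2 s y := by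
  rw [f_eq_rpow_add_iInf]
  exact le_add_of_nonneg_right (le_iInf₂ fun z _ => f_nonneg hσ _ z)

/-- The value of `F_s` at a sequence that consists of the entries `x j`, `j ∈ B`, in some order,
followed by zeros. -/
def finCost {ι : Type*} (α σ2 s : ℝ) (B : Finset ι) (x : ι → ℝ≥0) : ℝ :=
  ∑ j ∈ B, (x j : ℝ) ^ α + 1 / (2 * σ2) * (s - ∑ j ∈ B, (x j : ℝ)) ^ 2

lemma finCost_insert {ι : Type*} [DecidableEq ι] {B : Finset ι} {a : ι} (ha : a ∉ B)
    (α σ2 s : ℝ) (x : ι → ℝ≥0) :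
    finCost α σ2 s (insert a B) x = (x a : ℝ) ^ α + finCost α σ2 (s - x a) B x := by
  unfold finCost
  rw [Finset.sum_insert ha, Finset.sum_insert ha]
  ring

lemma f_zero_le (hα : 0 < α) (σ2 s : ℝ) :
    f α σ2 s 0 ≤ ((1 / (2 * σ2) * s ^ 2 : ℝ) : EReal) := by
  refine (iInf₂_le (fun _ => 0) ⟨antitone_const, rfl⟩).trans ?_
  rw [F_eq_coe_of_summable (by simp [NNReal.zero_rpow hα.ne']) summable_zero]
  simp [Real.zero_rpow hα.ne']

lemma f_sup_le_finCost {ι : Type*} (hα : 0 < α) (σ2 s : ℝ) (B : Finset ι) (x : ι → ℝ≥0) :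
    f α σ2 s (B.sup x) ≤ (finCost α σ2 s B x : EReal) := by
  classical
  induction B using Finset.induction_on_max_value x generalizing s with
  | empty => simpa [finCost] using f_zero_le hα σ2 s
  | insert a B ha hB ih =>
    have hsup : B.sup x ≤ x a := Finset.sup_le hB
    rw [Finset.sup_insert, sup_of_le_left hsup, finCost_insert ha, EReal.coe_add]
    exact (f_le_rpow_add_f s hsup).trans (add_le_add le_rfl (ih _))

lemma f_lt_top (hα : 0 < α) (σ2 s : ℝ) (y : ℝ≥0) : f α σ2 s y < ⊤ := by
  have h := f_sup_le_finCost hα σ2 s {0} (fun _ : ℕ => y)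
  rw [Finset.sup_singleton] at h
  exact h.trans_lt (EReal.coe_lt_top _)

lemma exists_finCost_lt {c : ℝ} (hσ : 0 < σ2) {y : ℝ≥0} (h : f α σ2 s y < c) :
    ∃ x : ℕ → ℝ≥0, ∃ k : ℕ, (∀ j, x j ≤ y) ∧ x 0 = y ∧
      finCost α σ2 s (Finset.range (k + 1)) x < c := by
  simp only [f, iInf_lt_iff] at h
  obtain ⟨x, ⟨hx, hx0⟩, hF⟩ := h
  have hpow := summable_rpow_of_F_lt_top hσ (hF.trans (EReal.coe_lt_top _))
  have hsum := summable_of_F_lt_top hσ (hF.trans (EReal.coe_lt_top _))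
  rw [F_eq_coe_of_summable hpow hsum, EReal.coe_lt_coe_iff] at hF
  have hpow_lim := (NNReal.summable_coe.2 hpow).hasSum.tendsto_sum_nat
  have hsum_lim := (NNReal.summable_coe.2 hsum).hasSum.tendsto_sum_nat
  have hlim : Tendsto (fun k => finCost α σ2 s (Finset.range (k + 1)) x) atTop (𝓝 _) :=
    (hpow_lim.add (((tendsto_const_nhds.sub hsum_lim).pow 2).const_mul (1 / (2 * σ2)))).comp
      (tendsto_add_atTop_nat 1)
  obtain ⟨k, hk⟩ := (hlim.eventually_lt_const (by simpa using hF)).exists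
  exact ⟨x, k, fun j => hx0 ▸ hx (Nat.zero_le j), hx0, hk⟩

lemma exists_iInf_f_eq_coe (hα₀ : 0 < α) (hσ : 0 < σ2) (s : ℝ) :
    ∃ I₀ : ℝ, ⨅ z, f α σ2 s z = (I₀ : EReal) := by
  have hnonneg : 0 ≤ ⨅ z, f α σ2 s z := le_iInf fun z => f_nonneg hσ s z
  have hlt : ⨅ z, f α σ2 s z < ⊤ := (iInf_le _ 0).trans_lt (f_lt_top hα₀ σ2 s 0)
  exact ⟨_, (EReal.coe_toReal hlt.ne (EReal.bot_lt_zero.trans_le hnonneg).ne').symm⟩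

/-- The sequence `x` cut off at height `y`, with its first entry replaced by `y`. It turns a
competitor for `f_s(y')` into one for `f_s(y)`. -/
def capAt (y : ℝ≥0) (x : ℕ → ℝ≥0) (j : ℕ) : ℝ≥0 := if j = 0 then y else min (x j) y

lemma sup_range_capAt (y : ℝ≥0) (x : ℕ → ℝ≥0) (k : ℕ) :
    (Finset.range (k + 1)).sup (capAt y x) = y := by
  refine le_antisymm (Finset.sup_le fun j _ => ?_) (Finset.le_sup (f := capAt y x) (b := 0) ?_)
  · unfold capAt
    split_ifs
    exacts [le_rfl, min_le_right _ _]
  · simp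

lemma sum_capAt_rpow_le (hα₀ : 0 ≤ α) (y : ℝ≥0) (x : ℕ → ℝ≥0) (k : ℕ) :
    ∑ j ∈ Finset.range (k + 1), (capAt y x j : ℝ) ^ α ≤
      ∑ j ∈ Finset.range (k + 1), (x j : ℝ) ^ α + |(y : ℝ) ^ α - (x 0 : ℝ) ^ α| := by
  have htail : ∑ j ∈ Finset.range k, (capAt y x (j + 1) : ℝ) ^ α ≤
      ∑ j ∈ Finset.range k, (x (j + 1) : ℝ) ^ α := by
    gcongr
    simp [capAt]
  rw [Finset.sum_range_succ', Finset.sum_range_succ', capAt, if_pos rfl]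
  linarith [le_abs_self ((y : ℝ) ^ α - (x 0 : ℝ) ^ α)]

lemma sub_min_le_rpow_mul_rpow {x y y' : ℝ} (hα₀ : 0 ≤ α) (hα₁ : α ≤ 1) (hx : 0 ≤ x)
    (hy : 0 ≤ y) (hxy' : x ≤ y') : x - min x y ≤ |y - y'| ^ (1 - α) * x ^ α := by
  rcases le_total x y with hle | hle
  · rw [min_eq_left hle, sub_self]
    positivity
  · have hu : 0 ≤ x - y := sub_nonneg.2 hle
    have hy' : x - y ≤ |y - y'| := by
      rw [abs_sub_comm]
      exact (sub_le_sub_right hxy' y).trans (le_abs_self _)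
    calc x - min x y = (x - y) ^ (1 - α) * (x - y) ^ α := by
          rw [min_eq_right hle, ← Real.rpow_add' hu (by simp), sub_add_cancel, Real.rpow_one]
      _ ≤ |y - y'| ^ (1 - α) * x ^ α := by
          gcongr
          exact sub_le_self x hy

lemma abs_sum_capAt_sub_sum_le (hα₀ : 0 ≤ α) (hα₁ : α ≤ 1) (y : ℝ≥0) {x : ℕ → ℝ≥0}
    (hx : ∀ j, x j ≤ x 0) (k : ℕ) :
    |∑ j ∈ Finset.range (k + 1), (capAt y x j : ℝ) - ∑ j ∈ Finset.range (k + 1), (x j : ℝ)| ≤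
      |(y : ℝ) - x 0| +
        |(y : ℝ) - x 0| ^ (1 - α) * ∑ j ∈ Finset.range (k + 1), (x j : ℝ) ^ α := by
  have hterm (j : ℕ) : |(capAt y x (j + 1) : ℝ) - x (j + 1)| ≤
      |(y : ℝ) - x 0| ^ (1 - α) * (x (j + 1) : ℝ) ^ α := by
    rw [capAt, if_neg (Nat.succ_ne_zero j), NNReal.coe_min, abs_sub_comm,
      abs_of_nonneg (sub_nonneg.2 (min_le_left _ _))]
    exact sub_min_le_rpow_mul_rpow hα₀ hα₁ (by positivity) (by positivity) (hx (j + 1))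
  rw [← Finset.sum_sub_distrib, Finset.sum_range_succ', add_comm, Finset.mul_sum,
    Finset.sum_range_succ' (fun j => |(y : ℝ) - x 0| ^ (1 - α) * (x j : ℝ) ^ α)]
  refine (abs_add_le _ _).trans (add_le_add (by simp [capAt]) ?_)
  refine (Finset.abs_sum_le_sum_abs _ _).trans ((Finset.sum_le_sum fun j _ => hterm j).trans ?_)
  exact le_add_of_nonneg_right (by positivity)

lemma sub_sq_le_sq_add {u D T Δ : ℝ} (hu : |u| ≤ T) (hD : |D| ≤ Δ) :
    (u - D) ^ 2 ≤ u ^ 2 + (2 * Δ * T + Δ ^ 2) := by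
  have hsq : D ^ 2 ≤ Δ ^ 2 := sq_le_sq' (abs_le.1 hD).1 (abs_le.1 hD).2
  have hmul : -(u * D) ≤ T * Δ := by
    refine (neg_le_abs _).trans ?_
    rw [abs_mul]
    gcongr
    exact (abs_nonneg u).trans hu
  nlinarith

/-- The amount by which `capAt` can raise a cost below `c` when `y'` is replaced by `y`. -/
def capError (α σ2 c : ℝ) (y y' : ℝ≥0) : ℝ :=
  |(y : ℝ) ^ α - (y' : ℝ) ^ α| + 1 / (2 * σ2) *
    (2 * (|(y : ℝ) - y'| + |(y : ℝ) - y'| ^ (1 - α) * c) * √(2 * σ2 * c) +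
      (|(y : ℝ) - y'| + |(y : ℝ) - y'| ^ (1 - α) * c) ^ 2)

lemma capError_self (hα₁ : α < 1) (c : ℝ) (y : ℝ≥0) : capError α σ2 c y y = 0 := by
  simp [capError, Real.zero_rpow (sub_pos.2 hα₁).ne']

lemma continuous_capError (hα₀ : 0 ≤ α) (hα₁ : α ≤ 1) (c : ℝ) (y : ℝ≥0) :
    Continuous (capError α σ2 c y) := by
  have hα₁' : 0 ≤ 1 - α := sub_nonneg.2 hα₁
  unfold capError
  fun_prop (disch := simp [*])

lemma finCost_capAt_le {c : ℝ} (hα₀ : 0 ≤ α) (hα₁ : α ≤ 1) (hσ : 0 < σ2) (y : ℝ≥0)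
    {x : ℕ → ℝ≥0} (hx : ∀ j, x j ≤ x 0) {k : ℕ}
    (hc : finCost α σ2 s (Finset.range (k + 1)) x ≤ c) :
    finCost α σ2 s (Finset.range (k + 1)) (capAt y x) ≤ c + capError α σ2 c y (x 0) := by
  unfold finCost at hc ⊢
  set A := ∑ j ∈ Finset.range (k + 1), (x j : ℝ) ^ α
  set S := ∑ j ∈ Finset.range (k + 1), (x j : ℝ)
  have hA : 0 ≤ A := Finset.sum_nonneg fun j _ => by positivity
  have hquad : 0 ≤ 1 / (2 * σ2) * (s - S) ^ 2 := by positivity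
  have hsqrt : |s - S| ≤ √(2 * σ2 * c) := by
    have hle : 1 / (2 * σ2) * (s - S) ^ 2 ≤ c := by linarith
    rw [one_div_mul_eq_div, div_le_iff₀' (by positivity)] at hle
    exact Real.abs_le_sqrt hle
  have hdiff : |∑ j ∈ Finset.range (k + 1), (capAt y x j : ℝ) - S| ≤
      |(y : ℝ) - x 0| + |(y : ℝ) - x 0| ^ (1 - α) * c := by
    refine (abs_sum_capAt_sub_sum_le hα₀ hα₁ y hx k).trans ?_
    gcongr
    linarith
  have hsq := mul_le_mul_of_nonneg_left (sub_sq_le_sq_add hsqrt hdiff)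
    (by positivity : 0 ≤ 1 / (2 * σ2))
  rw [sub_sub_sub_cancel_right, mul_add] at hsq
  have hpow := sum_capAt_rpow_le hα₀ y x k
  unfold capError
  linarith

lemma f_le_add_capError {c : ℝ} (hα₀ : 0 < α) (hα₁ : α ≤ 1) (hσ : 0 < σ2) (y : ℝ≥0) {y' : ℝ≥0}
    (h : f α σ2 s y' < c) : f α σ2 s y ≤ ((c + capError α σ2 c y y' : ℝ) : EReal) := by
  obtain ⟨x, k, hx, rfl, hc⟩ := exists_finCost_lt hσ h
  calc f α σ2 s y = f α σ2 s ((Finset.range (k + 1)).sup (capAt y x)) := by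
        rw [sup_range_capAt]
    _ ≤ finCost α σ2 s (Finset.range (k + 1)) (capAt y x) := f_sup_le_finCost hα₀ σ2 s _ _
    _ ≤ _ := EReal.coe_le_coe_iff.2 (finCost_capAt_le hα₀.le hα₁ hσ y hx hc.le)

lemma lowerSemicontinuous_f (hα₀ : 0 < α) (hα₁ : α < 1) (hσ : 0 < σ2) (s : ℝ) :
    LowerSemicontinuous (f α σ2 s) := by
  intro y J hJ
  obtain ⟨c, hJc, hc⟩ := EReal.lt_iff_exists_real_btwn.1 hJ
  obtain ⟨c', hcc', hc'⟩ := EReal.lt_iff_exists_real_btwn.1 hc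
  have hlim : Tendsto (fun y' => c + capError α σ2 c y y') (𝓝 y) (𝓝 c) := by
    simpa [capError_self hα₁] using
      ((continuous_capError hα₀.le hα₁.le c y).tendsto y).const_add c
  filter_upwards [hlim.eventually_lt_const (EReal.coe_lt_coe_iff.1 hcc')] with y' hy'
  by_contra hcon
  have hle := f_le_add_capError hα₀ hα₁.le hσ y ((not_lt.1 hcon).trans_lt hJc)
  exact (hle.trans_lt (EReal.coe_lt_coe_iff.2 hy')).not_ge hc'.le

lemma isCompact_sublevel_f (hα₀ : 0 < α) (hα₁ : α < 1) (hσ : 0 < σ2) (s c : ℝ) :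
    IsCompact {y : ℝ≥0 | f α σ2 s y ≤ c} := by
  refine IsCompact.of_isClosed_subset (isCompact_Icc (a := 0) (b := (c ^ (1 / α)).toNNReal))
    (lowerSemicontinuous_iff_isClosed_preimage.1 (lowerSemicontinuous_f hα₀ hα₁ hσ s) c)
    fun y hy => ⟨zero_le, NNReal.le_toNNReal_of_coe_le ?_⟩
  have hle : (y : ℝ) ^ α ≤ c := EReal.coe_le_coe_iff.1 ((rpow_le_f hσ s y).trans hy)
  calc (y : ℝ) = ((y : ℝ) ^ α) ^ (1 / α) := by
        rw [one_div, Real.rpow_rpow_inv (NNReal.coe_nonneg _) hα₀.ne']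
    _ ≤ c ^ (1 / α) := by gcongr

lemma isGoodRateFunction_f_sub (hα₀ : 0 < α) (hα₁ : α < 1) (hσ : 0 < σ2) (s : ℝ) :
    IsGoodRateFunction fun y : ℝ≥0 => f α σ2 s y - ⨅ z : ℝ≥0, f α σ2 s z := by
  obtain ⟨I₀, hI₀⟩ := exists_iInf_f_eq_coe hα₀ hσ s
  rw [hI₀]
  have hsub (y : ℝ≥0) (c : EReal) : f α σ2 s y - I₀ ≤ c ↔ f α σ2 s y ≤ c + I₀ :=
    EReal.sub_le_iff_le_add (by simp) (by simp)
  refine ⟨fun y => ?_, lowerSemicontinuous_iff_isClosed_preimage.2 fun c => ?_, fun c => ?_⟩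
  · rw [EReal.le_sub_iff_add_le (by simp) (by simp), zero_add, ← hI₀]
    exact iInf_le _ y
  · simpa only [Set.preimage, Set.mem_Iic, hsub] using
      lowerSemicontinuous_iff_isClosed_preimage.1 (lowerSemicontinuous_f hα₀ hα₁ hσ s) (c + I₀)
  · simpa only [hsub, ← EReal.coe_add] using isCompact_sublevel_f hα₀ hα₁ hσ s (c + I₀)

end RateFunction

/-! ### The stretched exponential weights -/

section Weight

variable {α η : ℝ}

lemma summable_one_add_pow_mul_exp_neg_mul_rpow (hα : 0 < α) (hη : 0 < η) (r : ℕ) :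
    Summable fun k : ℕ => (1 + (k : ℝ)) ^ r * Real.exp (-η * (k : ℝ) ^ α) := by
  have hexp : (fun k : ℕ => Real.exp (-η * (k : ℝ) ^ α)) =O[atTop]
      fun k : ℕ => ((k : ℝ) ^ α) ^ (-((r : ℝ) + 2) / α) :=
    ((isLittleO_exp_neg_mul_rpow_atTop hη _).comp_tendsto
      ((tendsto_rpow_atTop hα).comp tendsto_natCast_atTop_atTop)).isBigO
  have hpow : (fun k : ℕ => (1 + (k : ℝ)) ^ r) =O[atTop] fun k : ℕ => (k : ℝ) ^ r := by
    refine Asymptotics.IsBigO.pow (Asymptotics.IsBigO.of_bound 2 ?_) r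
    filter_upwards [eventually_ge_atTop 1] with k hk
    have hk' : (1 : ℝ) ≤ k := by exact_mod_cast hk
    rw [Real.norm_of_nonneg (by positivity), Real.norm_of_nonneg (by positivity)]
    linarith
  refine summable_of_isBigO_nat (Real.summable_nat_rpow.2 (by norm_num : (-2 : ℝ) < -1))
    ((hpow.mul hexp).congr' .rfl ?_)
  filter_upwards [eventually_ge_atTop 1] with k hk
  have hk' : (0 : ℝ) < k := by exact_mod_cast hk
  rw [← Real.rpow_mul hk'.le, mul_div_cancel₀ _ hα.ne', ← Real.rpow_natCast, ← Real.rpow_add hk']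
  ring_nf

/-- The probability weight `c exp (-k^α)`. -/
def weight (α : ℝ) (k : ℕ) : ℝ := normConst α * Real.exp (-(k : ℝ) ^ α)

lemma summable_exp_neg_rpow (hα : 0 < α) : Summable fun k : ℕ => Real.exp (-(k : ℝ) ^ α) := by
  simpa using summable_one_add_pow_mul_exp_neg_mul_rpow hα one_pos 0

lemma tsum_exp_neg_rpow_pos (hα : 0 < α) : 0 < ∑' k : ℕ, Real.exp (-(k : ℝ) ^ α) :=
  (summable_exp_neg_rpow hα).tsum_pos (fun _ => (Real.exp_pos _).le) 0 (Real.exp_pos _)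

lemma normConst_pos (hα : 0 < α) : 0 < normConst α :=
  one_div_pos.2 (tsum_exp_neg_rpow_pos hα)

lemma weight_pos (hα : 0 < α) (k : ℕ) : 0 < weight α k :=
  mul_pos (normConst_pos hα) (Real.exp_pos _)

lemma summable_weight (hα : 0 < α) : Summable (weight α) :=
  (summable_exp_neg_rpow hα).mul_left _

lemma tsum_weight (hα : 0 < α) : ∑' k, weight α k = 1 := by
  unfold weight
  rw [tsum_mul_left, normConst, one_div_mul_cancel (tsum_exp_neg_rpow_pos hα).ne']

lemma summable_weight_mul (hα : 0 < α) (hη : 0 < η) {C : ℝ} {r : ℕ} {g : ℕ → ℝ}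
    (hg : ∀ k : ℕ, |g k| ≤ C * (1 + (k : ℝ)) ^ r * Real.exp ((1 - η) * (k : ℝ) ^ α)) :
    Summable fun k => weight α k * g k := by
  refine Summable.of_norm_bounded
    ((summable_one_add_pow_mul_exp_neg_mul_rpow hα hη r).mul_left (normConst α * C)) fun k => ?_
  calc ‖weight α k * g k‖ = weight α k * |g k| := by
        rw [Real.norm_eq_abs, abs_mul, abs_of_pos (weight_pos hα k)]
    _ ≤ weight α k * (C * (1 + (k : ℝ)) ^ r * Real.exp ((1 - η) * (k : ℝ) ^ α)) :=
        mul_le_mul_of_nonneg_left (hg k) (weight_pos hα k).le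
    _ = normConst α * C * ((1 + (k : ℝ)) ^ r * Real.exp (-η * (k : ℝ) ^ α)) := by
        rw [show -η * (k : ℝ) ^ α = -(k : ℝ) ^ α + (1 - η) * (k : ℝ) ^ α by ring, Real.exp_add,
          weight]
        ring

lemma summable_weight_mul_pow (hα : 0 < α) (r : ℕ) :
    Summable fun k : ℕ => weight α k * (k : ℝ) ^ r := by
  refine summable_weight_mul hα one_pos (C := 1) (r := r) fun k => ?_
  rw [abs_of_nonneg (by positivity), sub_self, zero_mul, Real.exp_zero, one_mul, mul_one]
  gcongr
  linarith

lemma summable_weight_mul_natCast (hα : 0 < α) : Summable fun k : ℕ => weight α k * (k : ℝ) := by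
  simpa only [pow_one] using summable_weight_mul_pow hα 1

/-- The mean of the stretched exponential law. -/
def mean (α : ℝ) : ℝ := ∑' k : ℕ, weight α k * (k : ℝ)

/-- The variance of the stretched exponential law. -/
def var (α : ℝ) : ℝ := ∑' k : ℕ, weight α k * ((k : ℝ) - mean α) ^ 2

lemma mean_nonneg (hα : 0 < α) : 0 ≤ mean α :=
  tsum_nonneg fun k => mul_nonneg (weight_pos hα k).le k.cast_nonneg

lemma summable_weight_mul_sub_mean (hα : 0 < α) :
    Summable fun k : ℕ => weight α k * ((k : ℝ) - mean α) := by
  simpa only [mul_sub] using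
    (summable_weight_mul_natCast hα).sub ((summable_weight hα).mul_right (mean α))

lemma tsum_weight_mul_sub_mean (hα : 0 < α) : ∑' k : ℕ, weight α k * ((k : ℝ) - mean α) = 0 := by
  simp only [mul_sub]
  rw [(summable_weight_mul_natCast hα).tsum_sub ((summable_weight hα).mul_right _),
    tsum_mul_right, tsum_weight hα, one_mul]
  exact sub_self (mean α)

lemma summable_weight_mul_sq_sub_mean (hα : 0 < α) :
    Summable fun k : ℕ => weight α k * ((k : ℝ) - mean α) ^ 2 := by
  refine (((summable_weight_mul_pow hα 2).sub
    ((summable_weight_mul_natCast hα).mul_left (2 * mean α))).add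
    ((summable_weight hα).mul_right (mean α ^ 2))).congr fun k => ?_
  ring

lemma var_pos (hα : 0 < α) : 0 < var α := by
  have hterm (k : ℕ) : 0 ≤ weight α k * ((k : ℝ) - mean α) ^ 2 :=
    mul_nonneg (weight_pos hα k).le (sq_nonneg _)
  obtain ⟨k, hk⟩ : ∃ k : ℕ, (k : ℝ) ≠ mean α := by
    by_contra! h
    exact zero_ne_one ((Nat.cast_zero.symm.trans (h 0)).trans ((h 1).symm.trans Nat.cast_one))
  exact (summable_weight_mul_sq_sub_mean hα).tsum_pos hterm k
    (mul_pos (weight_pos hα k) (sq_pos_of_ne_zero (sub_ne_zero.2 hk)))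

end Weight

/-! ### The scale and the speed -/

section Scale

variable {α : ℝ}

/-- The scale `n^γ` of the fluctuations and of the large jumps, where `γ = 1 / (2 - α)`. -/
def scale (α : ℝ) (n : ℕ) : ℝ := (n : ℝ) ^ (1 / (2 - α))

/-- The speed `n^(γ α)` of the large deviation principle, where `γ = 1 / (2 - α)`. -/
def speed (α : ℝ) (n : ℕ) : ℝ := (n : ℝ) ^ (1 / (2 - α) * α)

lemma scale_pos {n : ℕ} (hn : 0 < n) : 0 < scale α n :=
  Real.rpow_pos_of_pos (Nat.cast_pos.2 hn) _

lemma speed_pos {n : ℕ} (hn : 0 < n) : 0 < speed α n :=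
  Real.rpow_pos_of_pos (Nat.cast_pos.2 hn) _

lemma speed_eq_scale_rpow (α : ℝ) (n : ℕ) : speed α n = scale α n ^ α :=
  Real.rpow_mul n.cast_nonneg _ _

lemma natCast_mul_speed (hα : α ≠ 2) {n : ℕ} (hn : 0 < n) : n * speed α n = scale α n ^ 2 := by
  have hn' : (0 : ℝ) < n := Nat.cast_pos.2 hn
  have h2 : 2 - α ≠ 0 := sub_ne_zero.2 hα.symm
  calc n * speed α n = (n : ℝ) ^ (1 : ℝ) * (n : ℝ) ^ (1 / (2 - α) * α) := by
        rw [Real.rpow_one, speed]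
    _ = scale α n ^ 2 := by
        rw [scale, ← Real.rpow_add hn', ← Real.rpow_mul_natCast hn'.le]
        congr 1
        field_simp
        norm_num

lemma speed_div_scale_mul_rpow {δ : ℝ} (hδ : 0 ≤ δ) {n : ℕ} (hn : 0 < n) :
    speed α n / scale α n * (δ * scale α n) ^ (1 - α) = δ ^ (1 - α) := by
  have hs : 0 < scale α n := scale_pos hn
  rw [Real.mul_rpow hδ hs.le, speed_eq_scale_rpow, Real.rpow_sub hs, Real.rpow_one]
  have := Real.rpow_pos_of_pos hs α
  field_simp

lemma tendsto_scale_atTop (hα : α < 2) : Tendsto (scale α) atTop atTop :=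
  (tendsto_rpow_atTop (one_div_pos.2 (sub_pos.2 hα))).comp tendsto_natCast_atTop_atTop

lemma tendsto_speed_atTop (hα₀ : 0 < α) (hα₁ : α < 2) : Tendsto (speed α) atTop atTop :=
  (tendsto_rpow_atTop (mul_pos (one_div_pos.2 (sub_pos.2 hα₁)) hα₀)).comp
    tendsto_natCast_atTop_atTop

lemma tendsto_speed_div_scale (hα : α < 1) :
    Tendsto (fun n => speed α n / scale α n) atTop (𝓝[>] 0) := by
  refine tendsto_nhdsWithin_iff.2 ⟨?_, ?_⟩
  · refine ((tendsto_rpow_neg_atTop (sub_pos.2 hα)).comp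
      (tendsto_scale_atTop (by linarith))).congr' ?_
    filter_upwards [eventually_gt_atTop 0] with n hn
    rw [Function.comp_apply, neg_sub, Real.rpow_sub (scale_pos hn), Real.rpow_one,
      speed_eq_scale_rpow]
  · filter_upwards [eventually_gt_atTop 0] with n hn
    exact div_pos (speed_pos hn) (scale_pos hn)

lemma eventually_le_exp_speed_mul (hα₀ : 0 < α) (hα₁ : α < 2) {δ : ℝ} (hδ : 0 < δ) (C : ℝ) :
    ∀ᶠ n in atTop, C ≤ Real.exp (speed α n * δ) :=
  (Real.tendsto_exp_atTop.comp
    ((tendsto_speed_atTop hα₀ hα₁).atTop_mul_const hδ)).eventually_ge_atTop C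

end Scale

/-! ### Exponential tilting with truncation -/

section Tilt

variable {α η b L lam : ℝ}

lemma abs_exp_sub_one_sub_le (u : ℝ) : |Real.exp u - 1 - u| ≤ u ^ 2 * Real.exp |u| := by
  have h := Complex.norm_exp_sub_sum_le_norm_mul_exp (u : ℂ) 2
  rw [Finset.sum_range_succ, Finset.sum_range_one] at h
  simp only [pow_zero, Nat.factorial_zero, Nat.cast_one, div_one, pow_one, Nat.factorial_one,
    Complex.norm_real, Real.norm_eq_abs, sq_abs, ← sub_sub] at h
  exact_mod_cast h

lemma tendsto_exp_mul_sub_one_sub_div_sq (v : ℝ) :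
    Tendsto (fun r : ℝ => (Real.exp (r * v) - 1 - r * v) / r ^ 2) (𝓝[≠] 0) (𝓝 (v ^ 2 / 2)) := by
  have htaylor := (Real.exp_sub_sum_range_succ_isLittleO_pow 2).comp_tendsto
    ((continuous_mul_const v).tendsto' 0 0 (zero_mul v))
  have hsq : ((fun x : ℝ => x ^ 2) ∘ fun r => r * v) =O[𝓝 0] fun r : ℝ => r ^ 2 :=
    Asymptotics.IsBigO.of_bound (v ^ 2) (Eventually.of_forall fun r => by simp [mul_pow, mul_comm])
  have hdiv := ((htaylor.trans_isBigO hsq).mono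
    (nhdsWithin_le_nhds (s := {0}ᶜ))).tendsto_div_nhds_zero
  rw [← tendsto_sub_nhds_zero_iff]
  refine hdiv.congr' ?_
  filter_upwards [self_mem_nhdsWithin] with r hr
  have hr' : r ≠ 0 := hr
  simp only [Function.comp_apply, Finset.sum_range_succ, Finset.sum_range_zero, Nat.factorial]
  field_simp
  push_cast
  ring

/-- The weight `exp (lam (k - mean))` for `k` below the truncation level `L`. Larger values get
the weight `b exp ((1 - η) k^α)`, up to the centering, which is still integrable: `b = 1` records
the cost of big jumps in upper bounds, and `b = 0` forbids big jumps in lower bounds. -/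
def tilt (α η b L lam : ℝ) (k : ℕ) : ℝ :=
  if (k : ℝ) ≤ L then Real.exp (lam * (k - mean α))
  else b * Real.exp ((1 - η) * (k : ℝ) ^ α - lam * mean α)

lemma tilt_of_le {k : ℕ} (hk : (k : ℝ) ≤ L) :
    tilt α η b L lam k = Real.exp (lam * (k - mean α)) :=
  if_pos hk

lemma tilt_of_lt {k : ℕ} (hk : L < k) :
    tilt α η b L lam k = b * Real.exp ((1 - η) * (k : ℝ) ^ α - lam * mean α) :=
  if_neg hk.not_ge

lemma tilt_nonneg (hb : 0 ≤ b) (k : ℕ) : 0 ≤ tilt α η b L lam k := by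
  unfold tilt
  split_ifs <;> positivity

lemma abs_mul_le_half_rpow (hα₁ : α ≤ 1) (hlam : |lam| * L ^ (1 - α) ≤ 1 / 2) {x : ℝ}
    (hx : 0 ≤ x) (hxL : x ≤ L) : |lam| * x ≤ x ^ α / 2 := by
  calc |lam| * x = |lam| * x ^ (1 - α) * x ^ α := by
        rw [mul_assoc, ← Real.rpow_add' hx (by simp), sub_add_cancel, Real.rpow_one]
    _ ≤ |lam| * L ^ (1 - α) * x ^ α := by gcongr
    _ ≤ 1 / 2 * x ^ α := by gcongr
    _ = x ^ α / 2 := by ring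

lemma abs_natCast_sub_mean_le (hα₀ : 0 < α) (k : ℕ) :
    |(k : ℝ) - mean α| ≤ (1 + mean α) * (1 + k) := by
  have hm := mean_nonneg hα₀
  rw [abs_le]
  constructor <;> nlinarith [mul_nonneg hm (k.cast_nonneg (α := ℝ)), k.cast_nonneg (α := ℝ)]

lemma abs_tilt_remainder_le_of_le (hα₀ : 0 < α) (hα₁ : α ≤ 1) (hη : η ≤ 1 / 2)
    (hlam : |lam| * L ^ (1 - α) ≤ 1 / 2) {k : ℕ} (hk : (k : ℝ) ≤ L) :
    |tilt α η b L lam k - 1 - lam * (k - mean α)| ≤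
      (lam * ((1 + mean α) * (1 + k))) ^ 2 *
        (Real.exp (|lam| * mean α) * Real.exp ((1 - η) * (k : ℝ) ^ α)) := by
  have hexponent : |lam * (k - mean α)| ≤ |lam| * mean α + (1 - η) * (k : ℝ) ^ α := by
    have hsplit : |lam * (k - mean α)| ≤ |lam| * k + |lam| * mean α := by
      rw [abs_mul, ← mul_add]
      gcongr
      refine (abs_sub _ _).trans_eq ?_
      rw [abs_of_nonneg (mean_nonneg hα₀), abs_of_nonneg k.cast_nonneg]
    have hhalf := abs_mul_le_half_rpow hα₁ hlam k.cast_nonneg hk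
    nlinarith [Real.rpow_nonneg (k.cast_nonneg (α := ℝ)) α]
  have hsq : (lam * (k - mean α)) ^ 2 ≤ (lam * ((1 + mean α) * (1 + k))) ^ 2 := by
    rw [mul_pow, mul_pow, ← sq_abs ((k : ℝ) - mean α)]
    gcongr
    exact abs_natCast_sub_mean_le hα₀ k
  rw [tilt_of_le hk, ← Real.exp_add]
  refine (abs_exp_sub_one_sub_le _).trans ?_
  gcongr

lemma abs_tilt_remainder_le_of_lt (hα₀ : 0 < α) (hη : η ≤ 1) (hb₀ : 0 ≤ b) (hb₁ : b ≤ 1)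
    {k : ℕ} (hk : L < k) :
    |tilt α η b L lam k - 1 - lam * (k - mean α)| ≤
      (Real.exp (|lam| * mean α) + 1 + |lam| * (1 + mean α)) * (1 + k) *
        Real.exp ((1 - η) * (k : ℝ) ^ α) := by
  set E := Real.exp ((1 - η) * (k : ℝ) ^ α) with hE
  have hE₁ : 1 ≤ E := Real.one_le_exp (mul_nonneg (sub_nonneg.2 hη) (by positivity))
  have htilt : |tilt α η b L lam k| ≤ Real.exp (|lam| * mean α) * E := by
    have hcenter : -(lam * mean α) ≤ |lam| * mean α := by
      rw [← neg_mul]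
      exact mul_le_mul_of_nonneg_right (neg_le_abs _) (mean_nonneg hα₀)
    rw [abs_of_nonneg (tilt_nonneg hb₀ k), tilt_of_lt hk, hE, ← Real.exp_add]
    exact (mul_le_of_le_one_left (Real.exp_pos _).le hb₁).trans
      (Real.exp_le_exp.2 (by linarith))
  have hlin : |lam * (k - mean α)| ≤ |lam| * (1 + mean α) * (1 + k) := by
    rw [abs_mul, mul_assoc]
    gcongr
    exact abs_natCast_sub_mean_le hα₀ k
  calc |tilt α η b L lam k - 1 - lam * (k - mean α)|
      ≤ |tilt α η b L lam k| + |1| + |lam * (k - mean α)| :=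
        (abs_sub _ _).trans (add_le_add_left (abs_sub _ _) _)
    _ ≤ Real.exp (|lam| * mean α) * E + 1 + |lam| * (1 + mean α) * (1 + k) := by
        rw [abs_one]
        gcongr
    _ ≤ Real.exp (|lam| * mean α) * ((1 + k) * E) + (1 + k) * E +
          |lam| * (1 + mean α) * ((1 + k) * E) := by
        have hm := mean_nonneg hα₀
        have hk₁ : (1 : ℝ) ≤ 1 + k := le_add_of_nonneg_right k.cast_nonneg
        gcongr
        · exact le_mul_of_one_le_left (by positivity) hk₁
        · exact one_le_mul_of_one_le_of_one_le hk₁ hE₁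
        · exact le_mul_of_one_le_right (by positivity) hE₁
    _ = _ := by ring

lemma abs_mul_le_abs_of_le_one {a ρ : ℝ} (hρ : 0 ≤ ρ) (hρ₁ : ρ ≤ 1) : |a * ρ| ≤ |a| := by
  rw [abs_mul, abs_of_nonneg hρ]
  exact mul_le_of_le_one_right (abs_nonneg a) hρ₁

lemma abs_tilt_remainder_le_sq_mul_of_le (hα₀ : 0 < α) (hα₁ : α ≤ 1) (hη : η ≤ 1 / 2)
    {a ρ : ℝ} (hρ : 0 ≤ ρ) (hρ₁ : ρ ≤ 1) (haL : |a * ρ| * L ^ (1 - α) ≤ 1 / 2) {k : ℕ}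
    (hk : (k : ℝ) ≤ L) :
    |tilt α η b L (a * ρ) k - 1 - a * ρ * (k - mean α)| ≤
      ρ ^ 2 * (a ^ 2 * (1 + mean α) ^ 2 * Real.exp (|a| * mean α) * (1 + (k : ℝ)) ^ 3 *
        Real.exp ((1 - η) * (k : ℝ) ^ α)) := by
  have hm := mean_nonneg hα₀
  set E := Real.exp ((1 - η) * (k : ℝ) ^ α)
  have hpow : (1 + (k : ℝ)) ^ 2 ≤ (1 + (k : ℝ)) ^ 3 :=
    pow_le_pow_right₀ (le_add_of_nonneg_right k.cast_nonneg) (by norm_num)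
  calc |tilt α η b L (a * ρ) k - 1 - a * ρ * (k - mean α)|
      ≤ (a * ρ * ((1 + mean α) * (1 + k))) ^ 2 * (Real.exp (|a * ρ| * mean α) * E) :=
        abs_tilt_remainder_le_of_le hα₀ hα₁ hη haL hk
    _ ≤ (a * ρ * ((1 + mean α) * (1 + k))) ^ 2 * (Real.exp (|a| * mean α) * E) := by
        rel [abs_mul_le_abs_of_le_one (a := a) hρ hρ₁]
    _ = ρ ^ 2 * (a ^ 2 * (1 + mean α) ^ 2 * Real.exp (|a| * mean α) * (1 + (k : ℝ)) ^ 2 * E) := by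
        ring
    _ ≤ _ := by gcongr

/-- Above the truncation level the factor `ρ²` is paid for by powers of `k`, since
`δ = ρ L^(1-α) ≤ ρ (1 + k)`. -/
lemma abs_tilt_remainder_le_sq_mul_of_lt (hα₀ : 0 < α) (hα₁ : α ≤ 1) (hη : η ≤ 1) (hb₀ : 0 ≤ b)
    (hb₁ : b ≤ 1) {a ρ δ : ℝ} (hρ : 0 ≤ ρ) (hρ₁ : ρ ≤ 1) (hδ : 0 < δ) (hL : 0 ≤ L)
    (hρL : ρ * L ^ (1 - α) = δ) {k : ℕ} (hk : L < k) :
    |tilt α η b L (a * ρ) k - 1 - a * ρ * (k - mean α)| ≤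
      ρ ^ 2 * ((δ ^ 2)⁻¹ * (Real.exp (|a| * mean α) + 1 + |a| * (1 + mean α)) *
        (1 + (k : ℝ)) ^ 3 * Real.exp ((1 - η) * (k : ℝ) ^ α)) := by
  have hm := mean_nonneg hα₀
  set C := Real.exp (|a| * mean α) + 1 + |a| * (1 + mean α) with hC
  set E := Real.exp ((1 - η) * (k : ℝ) ^ α)
  have hδk : δ ≤ ρ * (1 + k) := by
    rw [← hρL]
    gcongr
    calc L ^ (1 - α) ≤ (1 + (k : ℝ)) ^ (1 - α) :=
          Real.rpow_le_rpow hL (by linarith) (sub_nonneg.2 hα₁)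
      _ ≤ (1 + (k : ℝ)) ^ (1 : ℝ) := Real.rpow_le_rpow_of_exponent_le
          (le_add_of_nonneg_right k.cast_nonneg) (by linarith)
      _ = 1 + k := Real.rpow_one _
  calc |tilt α η b L (a * ρ) k - 1 - a * ρ * (k - mean α)|
      ≤ (Real.exp (|a * ρ| * mean α) + 1 + |a * ρ| * (1 + mean α)) * (1 + k) * E :=
        abs_tilt_remainder_le_of_lt hα₀ hη hb₀ hb₁ hk
    _ ≤ C * (1 + k) * E := by
        rw [hC]
        rel [abs_mul_le_abs_of_le_one (a := a) hρ hρ₁]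
    _ = (δ ^ 2)⁻¹ * C * (δ ^ 2 * (1 + k) * E) := by field_simp
    _ ≤ (δ ^ 2)⁻¹ * C * ((ρ * (1 + k)) ^ 2 * (1 + k) * E) := by gcongr
    _ = _ := by ring

lemma exists_abs_tilt_remainder_le (hα₀ : 0 < α) (hα₁ : α ≤ 1) (hη : η ≤ 1 / 2) (hb₀ : 0 ≤ b)
    (hb₁ : b ≤ 1) {a δ : ℝ} (hδ : 0 < δ) (ha : |a| * δ ≤ 1 / 2) :
    ∃ C : ℝ, 0 ≤ C ∧ ∀ ρ L : ℝ, 0 ≤ ρ → ρ ≤ 1 → 0 ≤ L → ρ * L ^ (1 - α) = δ → ∀ k : ℕ,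
      |tilt α η b L (a * ρ) k - 1 - a * ρ * (k - mean α)| ≤
        ρ ^ 2 * (C * (1 + (k : ℝ)) ^ 3 * Real.exp ((1 - η) * (k : ℝ) ^ α)) := by
  have hm := mean_nonneg hα₀
  refine ⟨a ^ 2 * (1 + mean α) ^ 2 * Real.exp (|a| * mean α) +
    (δ ^ 2)⁻¹ * (Real.exp (|a| * mean α) + 1 + |a| * (1 + mean α)), by positivity,
    fun ρ L hρ hρ₁ hL hρL k => ?_⟩
  rcases le_or_gt (k : ℝ) L with hk | hk
  · have haL : |a * ρ| * L ^ (1 - α) ≤ 1 / 2 := by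
      rwa [abs_mul, abs_of_nonneg hρ, mul_assoc, hρL]
    refine (abs_tilt_remainder_le_sq_mul_of_le hα₀ hα₁ hη hρ hρ₁ haL hk).trans ?_
    gcongr
    exact le_add_of_nonneg_right (by positivity)
  · refine (abs_tilt_remainder_le_sq_mul_of_lt hα₀ hα₁ (by linarith) hb₀ hb₁ hρ hρ₁ hδ hL hρL
      hk).trans ?_
    gcongr
    exact le_add_of_nonneg_left (by positivity)

end Tilt

section TiltMean

variable {α η b L lam a δ : ℝ}

lemma tilt_le_const_mul_exp (hα₀ : 0 < α) (hη : η ≤ 1) (hb : 0 ≤ b) (k : ℕ) :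
    tilt α η b L lam k ≤ (Real.exp (|lam| * (L + mean α)) + b * Real.exp (|lam| * mean α)) *
      Real.exp ((1 - η) * (k : ℝ) ^ α) := by
  have hm := mean_nonneg hα₀
  have hE : 1 ≤ Real.exp ((1 - η) * (k : ℝ) ^ α) :=
    Real.one_le_exp (mul_nonneg (sub_nonneg.2 hη) (by positivity))
  rcases le_or_gt (k : ℝ) L with hk | hk
  · have hexponent : lam * (k - mean α) ≤ |lam| * (L + mean α) := by
      refine (le_abs_self _).trans ?_
      rw [abs_mul]
      gcongr
      rw [abs_le]
      constructor <;> linarith [k.cast_nonneg (α := ℝ)]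
    rw [tilt_of_le hk]
    calc Real.exp (lam * (k - mean α)) ≤ Real.exp (|lam| * (L + mean α)) := by gcongr
      _ ≤ Real.exp (|lam| * (L + mean α)) + b * Real.exp (|lam| * mean α) :=
          le_add_of_nonneg_right (by positivity)
      _ ≤ _ := le_mul_of_one_le_right (by positivity) hE
  · have hexponent : -(lam * mean α) ≤ |lam| * mean α := by
      rw [← neg_mul]
      exact mul_le_mul_of_nonneg_right (neg_le_abs _) hm
    rw [tilt_of_lt hk, sub_eq_add_neg, add_comm, Real.exp_add, ← mul_assoc]
    gcongr
    exact (mul_le_mul_of_nonneg_left (Real.exp_le_exp.2 hexponent) hb).trans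
      (le_add_of_nonneg_left (Real.exp_pos _).le)

lemma summable_weight_mul_tilt (hα₀ : 0 < α) (hη : 0 < η) (hη₁ : η ≤ 1) (hb : 0 ≤ b) :
    Summable fun k => weight α k * tilt α η b L lam k := by
  refine summable_weight_mul hα₀ hη (r := 0)
    (C := Real.exp (|lam| * (L + mean α)) + b * Real.exp (|lam| * mean α)) fun k => ?_
  rw [abs_of_nonneg (tilt_nonneg hb k), pow_zero, mul_one]
  exact tilt_le_const_mul_exp hα₀ hη₁ hb k

/-- The expectation of `tilt` under the stretched exponential law. -/
def tiltMean (α η b L lam : ℝ) : ℝ := ∑' k, weight α k * tilt α η b L lam k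

lemma tiltMean_sub_one_eq_tsum (hα₀ : 0 < α) (hη : 0 < η) (hη₁ : η ≤ 1) (hb : 0 ≤ b) :
    tiltMean α η b L lam - 1 =
      ∑' k, weight α k * (tilt α η b L lam k - 1 - lam * (k - mean α)) := by
  have hsum : Summable fun k => weight α k * tilt α η b L lam k :=
    summable_weight_mul_tilt hα₀ hη hη₁ hb
  have hlin := (summable_weight_mul_sub_mean hα₀).mul_left lam
  have htsum := (hsum.sub (summable_weight hα₀)).tsum_sub hlin
  rw [hsum.tsum_sub (summable_weight hα₀), tsum_mul_left, tsum_weight_mul_sub_mean hα₀,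
    tsum_weight hα₀, mul_zero, sub_zero] at htsum
  rw [tiltMean, ← htsum]
  exact tsum_congr fun k => by ring

lemma tsum_weight_mul_sq_div_two (α a : ℝ) :
    ∑' k : ℕ, weight α k * ((a * (k - mean α)) ^ 2 / 2) = a ^ 2 * var α / 2 := by
  rw [var, ← tsum_mul_left, ← tsum_div_const]
  exact tsum_congr fun k => by ring

section Asymptotics

variable {ι : Type*} {l : Filter ι} {ρ L : ι → ℝ}

lemma tendsto_tilt_remainder_div_sq (hρ : Tendsto ρ l (𝓝[>] 0)) (hL : Tendsto L l atTop) (k : ℕ) :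
    Tendsto (fun i => (tilt α η b (L i) (a * ρ i) k - 1 - a * ρ i * (k - mean α)) / ρ i ^ 2) l
      (𝓝 ((a * (k - mean α)) ^ 2 / 2)) := by
  have hne : Tendsto ρ l (𝓝[≠] 0) := hρ.mono_right (nhdsWithin_mono _ fun _ hr => ne_of_gt hr)
  refine ((tendsto_exp_mul_sub_one_sub_div_sq (a * (k - mean α))).comp hne).congr' ?_
  filter_upwards [hL.eventually_ge_atTop (k : ℝ)] with i hi
  rw [Function.comp_apply, tilt_of_le hi, show ρ i * (a * (k - mean α)) = a * ρ i * (k - mean α) by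
    ring]

lemma tendsto_tiltMean_sub_one_div_sq (hα₀ : 0 < α) (hα₁ : α ≤ 1) (hη : 0 < η) (hη₁ : η ≤ 1 / 2)
    (hb₀ : 0 ≤ b) (hb₁ : b ≤ 1) (hδ : 0 < δ) (ha : |a| * δ ≤ 1 / 2)
    (hρ : Tendsto ρ l (𝓝[>] 0)) (hL : Tendsto L l atTop)
    (hρL : ∀ᶠ i in l, ρ i * L i ^ (1 - α) = δ) :
    Tendsto (fun i => (tiltMean α η b (L i) (a * ρ i) - 1) / ρ i ^ 2) l
      (𝓝 (a ^ 2 * var α / 2)) := by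
  obtain ⟨C, hC₀, hC⟩ := exists_abs_tilt_remainder_le hα₀ hα₁ hη₁ hb₀ hb₁ hδ ha
  have hdom : Summable fun k : ℕ =>
      weight α k * (C * (1 + (k : ℝ)) ^ 3 * Real.exp ((1 - η) * (k : ℝ) ^ α)) :=
    summable_weight_mul hα₀ hη fun k => (abs_of_nonneg (by positivity)).le
  have hlim := tendsto_tsum_of_dominated_convergence hdom
    (fun k => (tendsto_tilt_remainder_div_sq (α := α) (η := η) (b := b) (a := a) hρ hL k).const_mul
      (weight α k)) ?_
  · rw [tsum_weight_mul_sq_div_two] at hlim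
    refine hlim.congr fun i => ?_
    rw [tiltMean_sub_one_eq_tsum hα₀ hη (by linarith) hb₀, ← tsum_div_const]
    exact tsum_congr fun k => (mul_div_assoc _ _ _).symm
  · have hρ' := tendsto_nhdsWithin_iff.1 hρ
    filter_upwards [hρ'.1.eventually_le_const one_pos, hρ'.2, hL.eventually_ge_atTop 0, hρL]
      with i hρ₁ hρ₀ hL₀ hρLi k
    have hρ₀' : 0 < ρ i := hρ₀
    rw [norm_mul, Real.norm_of_nonneg (weight_pos hα₀ k).le, norm_div,
      Real.norm_of_nonneg (sq_nonneg (ρ i))]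
    refine mul_le_mul_of_nonneg_left ?_ (weight_pos hα₀ k).le
    exact (div_le_iff₀' (by positivity)).2 (hC (ρ i) (L i) hρ₀'.le hρ₁ hL₀ hρLi k)

lemma tendsto_one_of_tendsto_mul_sub_one {c M : ι → ℝ} {ℓ : ℝ} (hc : Tendsto c l atTop)
    (h : Tendsto (fun i => c i * (M i - 1)) l (𝓝 ℓ)) : Tendsto M l (𝓝 1) := by
  have hlim := ((tendsto_inv_atTop_zero.comp hc).mul h).add_const 1
  rw [zero_mul, zero_add] at hlim
  refine hlim.congr' ?_
  filter_upwards [hc.eventually_gt_atTop 0] with i hi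
  rw [Function.comp_apply, inv_mul_cancel_left₀ hi.ne', sub_add_cancel]

lemma tendsto_mul_log_of_tendsto_mul_sub_one {c M : ι → ℝ} {ℓ : ℝ} (hc : Tendsto c l atTop)
    (h : Tendsto (fun i => c i * (M i - 1)) l (𝓝 ℓ)) :
    Tendsto (fun i => c i * Real.log (M i)) l (𝓝 ℓ) := by
  have hM := tendsto_one_of_tendsto_mul_sub_one hc h
  have hMpos := hM.eventually_const_lt one_pos
  have hlower : Tendsto (fun i => c i * (1 - (M i)⁻¹)) l (𝓝 ℓ) := by
    have hlim := h.mul (hM.inv₀ one_ne_zero)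
    rw [inv_one, mul_one] at hlim
    refine hlim.congr' ?_
    filter_upwards [hMpos] with i hi
    field_simp
  refine tendsto_of_tendsto_of_tendsto_of_le_of_le' hlower h ?_ ?_
  · filter_upwards [hMpos, hc.eventually_ge_atTop 0] with i hi hci
    exact mul_le_mul_of_nonneg_left (Real.one_sub_inv_le_log_of_pos hi) hci
  · filter_upwards [hMpos, hc.eventually_ge_atTop 0] with i hi hci
    exact mul_le_mul_of_nonneg_left (Real.log_le_sub_one_of_pos hi) hci

lemma eventually_exp_le_pow_le_exp {M q : ι → ℝ} {N : ι → ℕ} {ℓ : ℝ} (hM : ∀ᶠ i in l, 0 < M i)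
    (hq : ∀ᶠ i in l, 0 < q i) (h : Tendsto (fun i => N i * Real.log (M i) / q i) l (𝓝 ℓ))
    {κ : ℝ} (hκ : 0 < κ) :
    ∀ᶠ i in l, Real.exp (q i * (ℓ - κ)) ≤ M i ^ N i ∧ M i ^ N i ≤ Real.exp (q i * (ℓ + κ)) := by
  filter_upwards [hM, hq, h.eventually_const_le (sub_lt_self ℓ hκ),
    h.eventually_le_const (lt_add_of_pos_right ℓ hκ)] with i hMi hqi hlower hupper
  rw [le_div_iff₀' hqi] at hlower
  rw [div_le_iff₀' hqi] at hupper
  rw [← Real.exp_log (pow_pos hMi (N i)), Real.log_pow]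
  exact ⟨Real.exp_le_exp.2 hlower, Real.exp_le_exp.2 hupper⟩

end Asymptotics

lemma eventually_exp_le_tiltMean_pow_le_exp (hα₀ : 0 < α) (hα₁ : α < 1) {ε : ℝ} (hε : 0 < ε)
    (hη : 0 < η) (hη₁ : η ≤ 1 / 2) (hb₀ : 0 ≤ b) (hb₁ : b ≤ 1) (ha : |a| * ε ^ (1 - α) ≤ 1 / 2)
    {N : ℕ → ℕ} (hN : Tendsto (fun n => (N n : ℝ) / n) atTop (𝓝 1)) {κ : ℝ} (hκ : 0 < κ) :
    ∀ᶠ n : ℕ in atTop,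
      Real.exp (speed α n * (a ^ 2 * var α / 2 - κ)) ≤
        tiltMean α η b (ε * scale α n) (a * (speed α n / scale α n)) ^ N n ∧
      tiltMean α η b (ε * scale α n) (a * (speed α n / scale α n)) ^ N n ≤
        Real.exp (speed α n * (a ^ 2 * var α / 2 + κ)) := by
  set ρ : ℕ → ℝ := fun n => speed α n / scale α n
  set M : ℕ → ℝ := fun n => tiltMean α η b (ε * scale α n) (a * ρ n)
  have hρ : Tendsto ρ atTop (𝓝[>] 0) := tendsto_speed_div_scale hα₁
  have hmean : Tendsto (fun n => (M n - 1) / ρ n ^ 2) atTop (𝓝 (a ^ 2 * var α / 2)) := by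
    refine tendsto_tiltMean_sub_one_div_sq hα₀ hα₁.le hη hη₁ hb₀ hb₁
      (Real.rpow_pos_of_pos hε (1 - α)) ha hρ
      ((tendsto_scale_atTop (by linarith)).const_mul_atTop hε) ?_
    filter_upwards [eventually_gt_atTop 0] with n hn using speed_div_scale_mul_rpow hε.le hn
  simp only [div_eq_inv_mul _ (ρ _ ^ 2), ← inv_pow] at hmean
  have hc : Tendsto (fun n => (ρ n)⁻¹ ^ 2) atTop atTop :=
    (tendsto_pow_atTop two_ne_zero).comp (tendsto_inv_nhdsGT_zero.comp hρ)
  have hlog := hN.mul (tendsto_mul_log_of_tendsto_mul_sub_one hc hmean)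
  rw [one_mul] at hlog
  refine eventually_exp_le_pow_le_exp
    ((tendsto_one_of_tendsto_mul_sub_one hc hmean).eventually_const_lt one_pos)
    ((eventually_gt_atTop 0).mono fun n hn => speed_pos hn) (hlog.congr' ?_) hκ
  filter_upwards [eventually_gt_atTop 0] with n hn
  have hspeed := speed_pos (α := α) hn
  have hscale := natCast_mul_speed (by linarith : α ≠ 2) hn
  rw [inv_div, div_pow, ← hscale]
  field_simp

end TiltMean

/-! ### Moments of independent variables with the stretched exponential law -/

section Law

variable {Ω : Type*} [MeasurableSpace Ω] {P : Measure Ω} {α : ℝ} {X : ℕ → Ω → ℕ} {g : ℕ → ℝ}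

lemma IsIIDStretchedExp.lintegral_comp (hX : IsIIDStretchedExp P α X) (i : ℕ) (g : ℕ → ℝ≥0∞) :
    ∫⁻ ω, g (X i ω) ∂P = ∑' k, g k * ENNReal.ofReal (weight α k) := by
  rw [← lintegral_map (measurable_of_countable g) (hX.measurable i), lintegral_countable']
  refine tsum_congr fun k => ?_
  rw [Measure.map_apply (hX.measurable i) (measurableSet_singleton k)]
  exact congrArg _ (hX.law i k)

lemma IsIIDStretchedExp.lintegral_ofReal_comp (hα : 0 < α) (hX : IsIIDStretchedExp P α X) (i : ℕ)
    (hg : ∀ k, 0 ≤ g k) (hsum : Summable fun k => weight α k * g k) :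
    ∫⁻ ω, ENNReal.ofReal (g (X i ω)) ∂P = ENNReal.ofReal (∑' k, weight α k * g k) := by
  rw [hX.lintegral_comp i fun k => ENNReal.ofReal (g k),
    ENNReal.ofReal_tsum_of_nonneg (fun k => mul_nonneg (weight_pos hα k).le (hg k)) hsum]
  refine tsum_congr fun k => ?_
  rw [ENNReal.ofReal_mul (weight_pos hα k).le, mul_comm]

lemma IsIIDStretchedExp.integral_comp (hα : 0 < α) (hX : IsIIDStretchedExp P α X) (i : ℕ)
    (hg : ∀ k, 0 ≤ g k) (hsum : Summable fun k => weight α k * g k) :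
    ∫ ω, g (X i ω) ∂P = ∑' k, weight α k * g k := by
  rw [integral_eq_lintegral_of_nonneg_ae (Eventually.of_forall fun ω => hg _)
    ((measurable_of_countable g).comp (hX.measurable i)).aestronglyMeasurable,
    hX.lintegral_ofReal_comp hα i hg hsum, ENNReal.toReal_ofReal]
  exact tsum_nonneg fun k => mul_nonneg (weight_pos hα k).le (hg k)

lemma IsIIDStretchedExp.integral_eq_mean (hα : 0 < α) (hX : IsIIDStretchedExp P α X) (i : ℕ) :
    ∫ ω, (X i ω : ℝ) ∂P = mean α :=
  hX.integral_comp hα i (fun k => k.cast_nonneg) (summable_weight_mul_natCast hα)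

lemma IsIIDStretchedExp.variance_eq_var (hα : 0 < α) (hX : IsIIDStretchedExp P α X) (i : ℕ) :
    Var[fun ω => (X i ω : ℝ); P] = var α := by
  have hmeas : Measurable fun ω => (X i ω : ℝ) :=
    (measurable_of_countable fun k : ℕ => (k : ℝ)).comp (hX.measurable i)
  rw [variance_eq_integral hmeas.aemeasurable, hX.integral_eq_mean hα]
  exact hX.integral_comp hα i (fun k => sq_nonneg ((k : ℝ) - mean α))
    (summable_weight_mul_sq_sub_mean hα)

lemma IsIIDStretchedExp.lintegral_prod (hα : 0 < α) (hX : IsIIDStretchedExp P α X)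
    (B : Finset ℕ) (hg : ∀ k, 0 ≤ g k) (hsum : Summable fun k => weight α k * g k) :
    ∫⁻ ω, ENNReal.ofReal (∏ i ∈ B, g (X i ω)) ∂P =
      ENNReal.ofReal ((∑' k, weight α k * g k) ^ B.card) := by
  have hprod := lintegral_prod_eq_prod_lintegral_of_indepFun (μ := P) B
    (fun i ω => ENNReal.ofReal (g (X i ω)))
    (hX.indep.comp (fun _ k => ENNReal.ofReal (g k)) fun _ => measurable_of_countable _)
    (fun i => (measurable_of_countable fun k => ENNReal.ofReal (g k)).comp (hX.measurable i))
  simp_rw [ENNReal.ofReal_prod_of_nonneg fun i _ => hg (X i _)]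
  rw [hprod, Finset.prod_congr rfl fun i _ => hX.lintegral_ofReal_comp hα i hg hsum,
    Finset.prod_const, ← ENNReal.ofReal_pow]
  exact tsum_nonneg fun k => mul_nonneg (weight_pos hα k).le (hg k)

lemma IsIIDStretchedExp.lintegral_prod_tilt (hα : 0 < α) (hX : IsIIDStretchedExp P α X)
    {η b : ℝ} (hη : 0 < η) (hη₁ : η ≤ 1) (hb : 0 ≤ b) (L lam : ℝ) (B : Finset ℕ) :
    ∫⁻ ω, ENNReal.ofReal (∏ i ∈ B, tilt α η b L lam (X i ω)) ∂P =
      ENNReal.ofReal (tiltMean α η b L lam ^ B.card) :=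
  hX.lintegral_prod hα B (tilt_nonneg hb) (summable_weight_mul_tilt hα hη hη₁ hb)

lemma IsIIDStretchedExp.measurable_prod_tilt (hX : IsIIDStretchedExp P α X) (η b L lam : ℝ)
    (B : Finset ℕ) : Measurable fun ω => ∏ i ∈ B, tilt α η b L lam (X i ω) :=
  Finset.measurable_prod _ fun i _ =>
    (measurable_of_countable (tilt α η b L lam)).comp (hX.measurable i)

lemma IsIIDStretchedExp.integrable_prod_tilt (hα : 0 < α) (hX : IsIIDStretchedExp P α X)
    {η b : ℝ} (hη : 0 < η) (hη₁ : η ≤ 1) (hb : 0 ≤ b) (L lam : ℝ) (B : Finset ℕ) :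
    Integrable (fun ω => ∏ i ∈ B, tilt α η b L lam (X i ω)) P := by
  refine ⟨(hX.measurable_prod_tilt η b L lam B).aestronglyMeasurable, ?_⟩
  rw [hasFiniteIntegral_iff_ofReal (Eventually.of_forall fun ω =>
    Finset.prod_nonneg fun i _ => tilt_nonneg hb _), hX.lintegral_prod_tilt hα hη hη₁ hb]
  exact ENNReal.ofReal_lt_top

lemma IsIIDStretchedExp.integral_prod_tilt (hα : 0 < α) (hX : IsIIDStretchedExp P α X)
    {η b : ℝ} (hη : 0 < η) (hη₁ : η ≤ 1) (hb : 0 ≤ b) (L lam : ℝ) (B : Finset ℕ) :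
    ∫ ω, ∏ i ∈ B, tilt α η b L lam (X i ω) ∂P = tiltMean α η b L lam ^ B.card := by
  have hmean : 0 ≤ tiltMean α η b L lam :=
    tsum_nonneg fun k => mul_nonneg (weight_pos hα k).le (tilt_nonneg hb k)
  rw [integral_eq_lintegral_of_nonneg_ae
    (Eventually.of_forall fun ω => Finset.prod_nonneg fun i _ => tilt_nonneg hb _)
    (hX.measurable_prod_tilt η b L lam B).aestronglyMeasurable,
    hX.lintegral_prod_tilt hα hη hη₁ hb, ENNReal.toReal_ofReal (pow_nonneg hmean _)]

lemma IsIIDStretchedExp.measurable_partialSum (hX : IsIIDStretchedExp P α X) (n : ℕ) :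
    Measurable (partialSum X n) :=
  Finset.measurable_sum _ fun i _ => hX.measurable i

lemma IsIIDStretchedExp.measurable_partialMax (hX : IsIIDStretchedExp P α X) (n : ℕ) :
    Measurable (partialMax X n) := by
  have hsup : partialMax X n = (Finset.range n).sup X := by
    ext ω
    rw [Finset.sup_apply, partialMax]
  rw [hsup]
  exact Finset.sup_induction measurable_const (fun _ h _ h' => h.sup h')
    fun i _ => hX.measurable i

end Law

/-! ### Upper bound for the joint probabilities -/

section UpperBound

variable {α ε η : ℝ} {n : ℕ}

lemma div_mul_self_sub_sq_mul_div_two {v : ℝ} (hv : v ≠ 0) (t : ℝ) :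
    t / v * t - (t / v) ^ 2 * v / 2 = 1 / (2 * v) * t ^ 2 := by
  field_simp
  ring

lemma exists_forall_le_abs_le_slope {v : ℝ} (hv : 0 < v) (J : ℝ) :
    ∃ T : ℝ, ∀ t, T ≤ |t| → ∃ a ∈ ({T / v, -T / v} : Finset ℝ), J ≤ a * t - a ^ 2 * v / 2 := by
  set T := √(2 * v * |J|) with hT
  have hvalue : T / v * T - (T / v) ^ 2 * v / 2 = |J| := by
    rw [div_mul_self_sub_sq_mul_div_two hv.ne', hT, Real.sq_sqrt (by positivity)]
    field_simp
  have hlarge {u : ℝ} (hu : T ≤ u) : J ≤ T / v * u - (T / v) ^ 2 * v / 2 := by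
    have hmono : T / v * T ≤ T / v * u :=
      mul_le_mul_of_nonneg_left hu (div_nonneg (Real.sqrt_nonneg _) hv.le)
    linarith [le_abs_self J]
  refine ⟨T, fun t ht => ?_⟩
  rcases le_abs.1 ht with ht | ht
  · exact ⟨T / v, by simp, hlarge ht⟩
  · refine ⟨-T / v, by simp, (hlarge ht).trans_eq ?_⟩
    ring

lemma exists_finset_slopes {v κ : ℝ} (hv : 0 < v) (hκ : 0 < κ) (J : ℝ) :
    ∃ G : Finset ℝ, ∀ t : ℝ, ∃ a ∈ G,
      min (1 / (2 * v) * t ^ 2 - κ) J ≤ a * t - a ^ 2 * v / 2 := by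
  classical
  obtain ⟨T, hT⟩ := exists_forall_le_abs_le_slope hv J
  obtain ⟨G, hG⟩ := isCompact_Icc.elim_finite_subcover (s := Set.Icc (-T) T)
    (fun a : ℝ => {t : ℝ | 1 / (2 * v) * t ^ 2 - κ < a * t - a ^ 2 * v / 2})
    (fun a => isOpen_lt (by fun_prop) (by fun_prop)) fun t _ => by
      refine Set.mem_iUnion.2 ⟨t / v, ?_⟩
      rw [Set.mem_ofPred_eq, div_mul_self_sub_sq_mul_div_two hv.ne']
      exact sub_lt_self _ hκ
  refine ⟨G ∪ {T / v, -T / v}, fun t => ?_⟩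
  rcases le_total T |t| with ht | ht
  · obtain ⟨a, ha, hat⟩ := hT t ht
    exact ⟨a, Finset.mem_union_right G ha, (min_le_right _ _).trans hat⟩
  · obtain ⟨a, ha, hat⟩ := Set.mem_iUnion₂.1 (hG (abs_le.1 ht))
    exact ⟨a, Finset.mem_union_left _ ha, (min_le_left _ _).trans hat.le⟩

lemma tilt_one_eq_exp (L lam : ℝ) (k : ℕ) :
    tilt α η 1 L lam k = Real.exp (lam * (k - mean α) +
      if L < k then (1 - η) * (k : ℝ) ^ α - lam * k else 0) := by
  rcases le_or_gt (k : ℝ) L with hk | hk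
  · rw [tilt_of_le hk, if_neg hk.not_gt, add_zero]
  · rw [tilt_of_lt hk, if_pos hk, one_mul]
    congr 1
    ring

lemma prod_tilt_one (L lam : ℝ) (B : Finset ℕ) (ξ : ℕ → ℕ) :
    ∏ i ∈ B, tilt α η 1 L lam (ξ i) =
      Real.exp (lam * (∑ i ∈ B, (ξ i : ℝ) - B.card * mean α - ∑ i ∈ B with L < ξ i, (ξ i : ℝ)) +
        (1 - η) * ∑ i ∈ B with L < ξ i, (ξ i : ℝ) ^ α) := by
  simp only [tilt_one_eq_exp]
  rw [← Real.exp_sum, Finset.sum_add_distrib, ← Finset.sum_filter, Finset.sum_sub_distrib,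
    ← Finset.mul_sum, ← Finset.mul_sum, ← Finset.mul_sum, Finset.sum_sub_distrib,
    Finset.sum_const, nsmul_eq_mul]
  congr 1
  ring

/-- The value `k / n^γ` of a variable on the scale of the large deviation principle. -/
def scaled (α : ℝ) (n k : ℕ) : ℝ≥0 := (k : ℝ≥0) / (n : ℝ≥0) ^ (1 / (2 - α))

lemma coe_scaled (α : ℝ) (n k : ℕ) : (scaled α n k : ℝ) = k / scale α n := by
  rw [scaled, scale, NNReal.coe_div, NNReal.coe_rpow, NNReal.coe_natCast, NNReal.coe_natCast]

lemma scaled_mono (α : ℝ) (n : ℕ) : Monotone (scaled α n) := fun k l hkl => by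
  have : (k : ℝ≥0) ≤ l := Nat.cast_le.2 hkl
  unfold scaled
  gcongr

lemma scaled_rpow (α : ℝ) (n k : ℕ) : (scaled α n k : ℝ) ^ α = (k : ℝ) ^ α / speed α n := by
  have hscale : 0 ≤ scale α n := Real.rpow_nonneg n.cast_nonneg _
  rw [coe_scaled, Real.div_rpow k.cast_nonneg hscale, speed_eq_scale_rpow]

/-- The indices below `n` whose entries exceed `ε n^γ`. -/
def bigEntries (α ε : ℝ) (n : ℕ) (ξ : ℕ → ℕ) : Finset ℕ :=
  {i ∈ Finset.range n | ε * scale α n < ξ i}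

lemma prod_tilt_range (hn : 0 < n) {t : ℝ} {ξ : ℕ → ℕ}
    (hsum : ∑ i ∈ Finset.range n, (ξ i : ℝ) = mean α * n + t * scale α n) (ε η a : ℝ) :
    ∏ i ∈ Finset.range n, tilt α η 1 (ε * scale α n) (a * (speed α n / scale α n)) (ξ i) =
      Real.exp (speed α n * (a * (t - ∑ i ∈ bigEntries α ε n ξ, (scaled α n (ξ i) : ℝ)) +
        (1 - η) * ∑ i ∈ bigEntries α ε n ξ, (scaled α n (ξ i) : ℝ) ^ α)) := by
  have hscale : 0 < scale α n := scale_pos hn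
  have hspeed : 0 < speed α n := speed_pos hn
  simp only [scaled_rpow]
  simp only [coe_scaled]
  rw [prod_tilt_one, hsum, Finset.card_range, ← bigEntries, ← Finset.sum_div, ← Finset.sum_div]
  congr 1
  field_simp
  ring

lemma sup_scaled_bigEntries_mem {A : Set ℝ≥0} (hn : 0 < n)
    (hε : 0 ∉ A → ∀ y ∈ A, ε < (y : ℝ)) {ξ : ℕ → ℕ}
    (hmax : scaled α n ((Finset.range n).sup ξ) ∈ A) :
    ((bigEntries α ε n ξ).sup fun i => scaled α n (ξ i)) ∈ A := by
  obtain ⟨i₀, hi₀, hsup⟩ := Finset.exists_mem_eq_sup (Finset.range n)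
    (Finset.nonempty_range_iff.2 hn.ne') ξ
  have hle {i : ℕ} (hi : i ∈ Finset.range n) : ξ i ≤ ξ i₀ := hsup ▸ Finset.le_sup hi
  rw [hsup] at hmax
  rcases le_or_gt (ξ i₀ : ℝ) (ε * scale α n) with hsmall | hbig
  · have hempty : bigEntries α ε n ξ = ∅ := Finset.filter_eq_empty_iff.2 fun i hi =>
      ((Nat.cast_le.2 (hle hi)).trans hsmall).not_gt
    rw [hempty, Finset.sup_empty]
    by_contra hzero
    have := hε hzero _ hmax
    rw [coe_scaled, lt_div_iff₀ (scale_pos hn)] at this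
    linarith
  · convert hmax using 1
    exact le_antisymm
      (Finset.sup_le fun i hi => scaled_mono α n (hle (Finset.mem_filter.1 hi).1))
      (Finset.le_sup (f := fun i => scaled α n (ξ i)) (Finset.mem_filter.2 ⟨hi₀, hbig⟩))

lemma le_finCost_bigEntries {σ2 s J : ℝ} (hα : 0 < α) {A : Set ℝ≥0}
    (hA : ∀ y ∈ A, (J : EReal) ≤ f α σ2 s y) (hε : 0 ∉ A → ∀ y ∈ A, ε < (y : ℝ)) (hn : 0 < n)
    {ξ : ℕ → ℕ} (hmax : scaled α n ((Finset.range n).sup ξ) ∈ A) :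
    J ≤ finCost α σ2 s (bigEntries α ε n ξ) fun i => scaled α n (ξ i) :=
  EReal.coe_le_coe_iff.1 <|
    (hA _ (sup_scaled_bigEntries_mem hn hε hmax)).trans (f_sup_le_finCost hα σ2 s _ _)

lemma add_sub_le_of_min_le {W q J κ Λ : ℝ} (hW : 0 ≤ W) (hq : 0 ≤ q) (hJ : J ≤ W + q)
    (hη₀ : 0 ≤ η) (hη₁ : η ≤ 1) (hηJ : η * J ≤ κ) (hκ : 0 ≤ κ) (hΛ : min (q - κ) J ≤ Λ) :
    J - 2 * κ ≤ Λ + (1 - η) * W := by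
  have hηW : 0 ≤ (1 - η) * W := mul_nonneg (sub_nonneg.2 hη₁) hW
  rcases min_le_iff.1 hΛ with hΛ | hΛ
  · have hscaled : (1 - η) * J ≤ (1 - η) * (W + q) :=
      mul_le_mul_of_nonneg_left hJ (sub_nonneg.2 hη₁)
    linarith [mul_nonneg hη₀ hq]
  · linarith

lemma exists_slope_exp_le_prod_tilt {σ2 s t J κ : ℝ} (hα : 0 < α) (hσ : 0 < σ2) (hη₀ : 0 ≤ η)
    (hη₁ : η ≤ 1) (hηJ : η * J ≤ κ) (hκ : 0 ≤ κ) {A : Set ℝ≥0}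
    (hA : ∀ y ∈ A, (J : EReal) ≤ f α σ2 s y) (hε : 0 ∉ A → ∀ y ∈ A, ε < (y : ℝ)) {G : Finset ℝ}
    (hG : ∀ t : ℝ, ∃ a ∈ G, min (1 / (2 * σ2) * t ^ 2 - κ) J ≤ a * t - a ^ 2 * σ2 / 2)
    (ht : ∀ a ∈ G, -κ ≤ a * (t - s)) (hn : 0 < n) {ξ : ℕ → ℕ}
    (hsum : ∑ i ∈ Finset.range n, (ξ i : ℝ) = mean α * n + t * scale α n)
    (hmax : scaled α n ((Finset.range n).sup ξ) ∈ A) :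
    ∃ a ∈ G, Real.exp (speed α n * (a ^ 2 * σ2 / 2 + (J - 3 * κ))) ≤
      ∏ i ∈ Finset.range n, tilt α η 1 (ε * scale α n) (a * (speed α n / scale α n)) (ξ i) := by
  have hcost := le_finCost_bigEntries hα hA hε hn hmax
  rw [finCost] at hcost
  set U := ∑ i ∈ bigEntries α ε n ξ, (scaled α n (ξ i) : ℝ)
  set W := ∑ i ∈ bigEntries α ε n ξ, (scaled α n (ξ i) : ℝ) ^ α
  obtain ⟨a, ha, hslope⟩ := hG (s - U)
  refine ⟨a, ha, ?_⟩
  rw [prod_tilt_range hn hsum]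
  refine Real.exp_le_exp.2 (mul_le_mul_of_nonneg_left ?_ (speed_pos hn).le)
  have hW : 0 ≤ W := Finset.sum_nonneg fun i _ => by positivity
  linarith [ht a ha, add_sub_le_of_min_le hW (by positivity) hcost hη₀ hη₁ hηJ hκ hslope]

lemma eventually_abs_mul_rpow_le_half (hα : α < 1) (a : ℝ) :
    ∀ᶠ ε in 𝓝[>] (0 : ℝ), |a| * ε ^ (1 - α) ≤ 1 / 2 := by
  have hcont : ContinuousAt (fun ε : ℝ => |a| * ε ^ (1 - α)) 0 :=
    continuousAt_const.mul (Real.continuousAt_rpow_const _ _ (Or.inr (by linarith)))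
  have hlim := hcont.tendsto
  rw [Real.zero_rpow (by linarith), mul_zero] at hlim
  exact (hlim.mono_left nhdsWithin_le_nhds).eventually_le_const one_half_pos

lemma eventually_forall_mem_lt_coe {A : Set ℝ≥0} (hA : IsClosed A) :
    ∀ᶠ ε in 𝓝[>] (0 : ℝ), 0 ∉ A → ∀ y ∈ A, ε < (y : ℝ) := by
  by_cases hzero : 0 ∈ A
  · exact Eventually.of_forall fun ε h => absurd hzero h
  obtain ⟨ρ, hρ, hball⟩ := Metric.isOpen_iff.1 hA.isOpen_compl 0 hzero
  filter_upwards [nhdsWithin_le_nhds (eventually_lt_nhds hρ)] with ε hερ _ y hy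
  refine hερ.trans_le (not_lt.1 fun hlt => hball ?_ hy)
  rw [Metric.mem_ball, NNReal.dist_eq]
  simpa using hlt

lemma exists_mul_le {J κ : ℝ} (hJ : 0 ≤ J) (hκ : 0 < κ) :
    ∃ η : ℝ, 0 < η ∧ η ≤ 1 / 2 ∧ η * J ≤ κ := by
  refine ⟨min (1 / 2) (κ / (J + 1)), by positivity, min_le_left _ _, ?_⟩
  calc min (1 / 2) (κ / (J + 1)) * J ≤ κ / (J + 1) * (J + 1) :=
        mul_le_mul (min_le_right _ _) (by linarith) hJ (by positivity)
    _ = κ := div_mul_cancel₀ κ (by positivity)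

/-- The event `S_n = μ n + t n^γ`, `M_n / n^γ ∈ A`. -/
def jointEvent {Ω : Type*} (X : ℕ → Ω → ℕ) (α t : ℝ) (n : ℕ) (A : Set ℝ≥0) : Set Ω :=
  {ω | (partialSum X n ω : ℝ) = mean α * n + t * scale α n ∧ scaled α n (partialMax X n ω) ∈ A}

lemma jointEvent_subset_biUnion {Ω : Type*} {X : ℕ → Ω → ℕ} {σ2 s t J κ : ℝ} (hα : 0 < α)
    (hσ : 0 < σ2) (hη₀ : 0 ≤ η) (hη₁ : η ≤ 1) (hηJ : η * J ≤ κ) (hκ : 0 ≤ κ) {A : Set ℝ≥0}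
    (hA : ∀ y ∈ A, (J : EReal) ≤ f α σ2 s y) (hε : 0 ∉ A → ∀ y ∈ A, ε < (y : ℝ)) {G : Finset ℝ}
    (hG : ∀ t : ℝ, ∃ a ∈ G, min (1 / (2 * σ2) * t ^ 2 - κ) J ≤ a * t - a ^ 2 * σ2 / 2)
    (ht : ∀ a ∈ G, -κ ≤ a * (t - s)) (hn : 0 < n) :
    jointEvent X α t n A ⊆ ⋃ a ∈ G,
      {ω | Real.exp (speed α n * (a ^ 2 * σ2 / 2 + (J - 3 * κ))) ≤ ∏ i ∈ Finset.range n,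
        tilt α η 1 (ε * scale α n) (a * (speed α n / scale α n)) (X i ω)} := by
  rintro ω ⟨hsum, hmax⟩
  rw [partialSum, Nat.cast_sum] at hsum
  obtain ⟨a, ha, hle⟩ :=
    exists_slope_exp_le_prod_tilt hα hσ hη₀ hη₁ hηJ hκ hA hε hG ht hn hsum hmax
  exact Set.mem_biUnion ha hle

variable {Ω : Type*} [MeasurableSpace Ω] {P : Measure Ω} {X : ℕ → Ω → ℕ}

lemma IsIIDStretchedExp.measure_exp_le_prod_tilt_le (hα : 0 < α) (hX : IsIIDStretchedExp P α X)
    (hη : 0 < η) (hη₁ : η ≤ 1) {b : ℝ} (hb : 0 ≤ b) (L lam c : ℝ) (B : Finset ℕ) :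
    P {ω | Real.exp c ≤ ∏ i ∈ B, tilt α η b L lam (X i ω)} ≤
      ENNReal.ofReal (tiltMean α η b L lam ^ B.card * Real.exp (-c)) := by
  have hmeas : Measurable fun ω => ENNReal.ofReal (∏ i ∈ B, tilt α η b L lam (X i ω)) :=
    (hX.measurable_prod_tilt η b L lam B).ennreal_ofReal
  calc P {ω | Real.exp c ≤ ∏ i ∈ B, tilt α η b L lam (X i ω)}
      ≤ P {ω | ENNReal.ofReal (Real.exp c) ≤
          ENNReal.ofReal (∏ i ∈ B, tilt α η b L lam (X i ω))} :=
        measure_mono fun ω => ENNReal.ofReal_le_ofReal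
    _ ≤ (∫⁻ ω, ENNReal.ofReal (∏ i ∈ B, tilt α η b L lam (X i ω)) ∂P) /
          ENNReal.ofReal (Real.exp c) :=
        meas_ge_le_lintegral_div hmeas.aemeasurable
          (ENNReal.ofReal_pos.2 (Real.exp_pos c)).ne' ENNReal.ofReal_ne_top
    _ = ENNReal.ofReal (tiltMean α η b L lam ^ B.card * Real.exp (-c)) := by
        rw [hX.lintegral_prod_tilt hα hη hη₁ hb, ← ENNReal.ofReal_div_of_pos (Real.exp_pos c),
          Real.exp_neg, div_eq_mul_inv]

lemma tendsto_natCast_div_self : Tendsto (fun n : ℕ => (n : ℝ) / n) atTop (𝓝 1) :=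
  tendsto_const_nhds.congr' <| (eventually_ne_atTop 0).mono fun _ hn =>
    (div_self (Nat.cast_ne_zero.2 hn)).symm

lemma IsIIDStretchedExp.eventually_measure_exp_le_prod_tilt_le (hα₀ : 0 < α) (hα₁ : α < 1)
    (hX : IsIIDStretchedExp P α X) (hε : 0 < ε) (hη : 0 < η) (hη₁ : η ≤ 1 / 2) {a κ : ℝ}
    (ha : |a| * ε ^ (1 - α) ≤ 1 / 2) (hκ : 0 < κ) (c : ℝ) :
    ∀ᶠ n : ℕ in atTop,
      P {ω | Real.exp (speed α n * (a ^ 2 * var α / 2 + c)) ≤ ∏ i ∈ Finset.range n,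
        tilt α η 1 (ε * scale α n) (a * (speed α n / scale α n)) (X i ω)} ≤
      ENNReal.ofReal (Real.exp (-speed α n * (c - κ))) := by
  filter_upwards [eventually_exp_le_tiltMean_pow_le_exp hα₀ hα₁ hε hη hη₁ zero_le_one le_rfl ha
    tendsto_natCast_div_self hκ] with n hpow
  refine (hX.measure_exp_le_prod_tilt_le hα₀ hη (by linarith) zero_le_one _ _ _ _).trans
    (ENNReal.ofReal_le_ofReal ?_)
  rw [Finset.card_range]
  refine (mul_le_mul_of_nonneg_right hpow.2 (Real.exp_pos _).le).trans_eq ?_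
  rw [← Real.exp_add]
  congr 1
  ring

lemma IsIIDStretchedExp.eventually_measure_jointEvent_le_of_nonneg (hα₀ : 0 < α) (hα₁ : α < 1)
    (hX : IsIIDStretchedExp P α X) {s J κ : ℝ} {sn : ℕ → ℝ} (hs : Tendsto sn atTop (𝓝 s))
    {A : Set ℝ≥0} (hAc : IsClosed A) (hA : ∀ y ∈ A, (J : EReal) ≤ f α (var α) s y) (hJ : 0 ≤ J)
    (hκ : 0 < κ) :
    ∀ᶠ n : ℕ in atTop, P (jointEvent X α (sn n) n A) ≤
      ENNReal.ofReal (Real.exp (-speed α n * (J - 5 * κ))) := by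
  obtain ⟨η, hη, hη₁, hηJ⟩ := exists_mul_le hJ hκ
  obtain ⟨G, hG⟩ := exists_finset_slopes (var_pos hα₀) hκ J
  obtain ⟨ε, hε, hεA, hεG⟩ := (eventually_mem_nhdsWithin.and ((eventually_forall_mem_lt_coe hAc).and
    ((Finset.eventually_all G).2 fun a _ => eventually_abs_mul_rpow_le_half hα₁ a))).exists
  have htilt := (Finset.eventually_all G).2 fun a ha =>
    hX.eventually_measure_exp_le_prod_tilt_le hα₀ hα₁ hε hη hη₁ (hεG a ha) hκ (J - 3 * κ)
  have hsn : ∀ᶠ n in atTop, ∀ a ∈ G, -κ ≤ a * (sn n - s) := by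
    refine (Finset.eventually_all G).2 fun a _ => ?_
    have hlim := (hs.sub_const s).const_mul a
    rw [sub_self, mul_zero] at hlim
    exact hlim.eventually_const_le (neg_lt_zero.2 hκ)
  filter_upwards [htilt, hsn, eventually_le_exp_speed_mul hα₀ (by linarith) hκ G.card,
    eventually_gt_atTop 0] with n htilt hsn hcard hn
  refine (measure_mono (jointEvent_subset_biUnion hα₀ (var_pos hα₀) hη.le (by linarith) hηJ hκ.le
    hA hεA hG hsn hn)).trans ((measure_biUnion_finset_le G _).trans ?_)
  refine (Finset.sum_le_sum htilt).trans ?_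
  rw [Finset.sum_const, nsmul_eq_mul, ← ENNReal.ofReal_natCast,
    ← ENNReal.ofReal_mul (Nat.cast_nonneg _)]
  refine ENNReal.ofReal_le_ofReal ?_
  calc (G.card : ℝ) * Real.exp (-speed α n * (J - 3 * κ - κ))
      ≤ Real.exp (speed α n * κ) * Real.exp (-speed α n * (J - 3 * κ - κ)) := by rel [hcard]
    _ = Real.exp (-speed α n * (J - 5 * κ)) := by
        rw [← Real.exp_add]
        congr 1
        ring

lemma IsIIDStretchedExp.eventually_measure_jointEvent_le (hα₀ : 0 < α) (hα₁ : α < 1)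
    (hX : IsIIDStretchedExp P α X) {s J J' : ℝ} {sn : ℕ → ℝ} (hs : Tendsto sn atTop (𝓝 s))
    {A : Set ℝ≥0} (hAc : IsClosed A) (hA : ∀ y ∈ A, (J : EReal) ≤ f α (var α) s y)
    (hJ : J' < J) :
    ∀ᶠ n : ℕ in atTop, P (jointEvent X α (sn n) n A) ≤
      ENNReal.ofReal (Real.exp (-speed α n * J')) := by
  have hA' (y : ℝ≥0) (hy : y ∈ A) : ((max J 0 : ℝ) : EReal) ≤ f α (var α) s y := by
    rcases le_total J 0 with hJ₀ | hJ₀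
    · exact (max_eq_right hJ₀).symm ▸ f_nonneg (var_pos hα₀) s y
    · exact (max_eq_left hJ₀).symm ▸ hA y hy
  have hgap : 0 < (max J 0 - J') / 5 := by linarith [le_max_left J 0]
  convert hX.eventually_measure_jointEvent_le_of_nonneg hα₀ hα₁ hs hAc hA' (le_max_right J 0) hgap
    using 7
  ring

end UpperBound

/-! ### Moderate deviations of the bulk -/

section Bulk

variable {Ω : Type*} {X : ℕ → Ω → ℕ} {α η c r L lam θ : ℝ} {N : ℕ}

lemma prod_tilt_of_le {b : ℝ} {B : Finset ℕ} {ξ : ℕ → ℕ} (hξ : ∀ i ∈ B, (ξ i : ℝ) ≤ L) :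
    ∏ i ∈ B, tilt α η b L lam (ξ i) =
      Real.exp (lam * (∑ i ∈ B, (ξ i : ℝ) - mean α * B.card)) := by
  rw [Finset.prod_congr rfl fun i hi => tilt_of_le (hξ i hi), ← Real.exp_sum, ← Finset.mul_sum,
    Finset.sum_sub_distrib, Finset.sum_const, nsmul_eq_mul, mul_comm (B.card : ℝ)]

/-- The event that `S_N` is within distance `r` of `μ N + c` and that none of the first `N`
variables exceeds `L`. -/
def bulkEvent (X : ℕ → Ω → ℕ) (α c r L : ℝ) (N : ℕ) : Set Ω :=
  {ω | |(partialSum X N ω : ℝ) - mean α * N - c| ≤ r ∧ (partialMax X N ω : ℝ) ≤ L}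

lemma bulkEvent_mono {L' : ℝ} (hL : L ≤ L') : bulkEvent X α c r L N ⊆ bulkEvent X α c r L' N :=
  fun _ hω => ⟨hω.1, hω.2.trans hL⟩

lemma prod_tilt_of_partialMax_le {b : ℝ} {ω : Ω} (hω : (partialMax X N ω : ℝ) ≤ L) :
    ∏ i ∈ Finset.range N, tilt α η b L lam (X i ω) =
      Real.exp (lam * (partialSum X N ω - mean α * N)) := by
  rw [prod_tilt_of_le fun i hi => (Nat.cast_le.2 (Finset.le_sup (f := fun i => X i ω) hi)).trans hω,
    Finset.card_range, partialSum, Nat.cast_sum]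

lemma prod_tilt_zero_of_lt_partialMax (hL : 0 ≤ L) {ω : Ω} (hω : L < partialMax X N ω) :
    ∏ i ∈ Finset.range N, tilt α η 0 L lam (X i ω) = 0 := by
  obtain ⟨i, hi, hlt⟩ := Finset.lt_sup_iff.1 ((Nat.floor_lt hL).2 hω)
  exact Finset.prod_eq_zero hi (by rw [tilt_of_lt ((Nat.floor_lt hL).1 hlt), zero_mul])

/-- Outside of the window `|x - c| ≤ r`, raising or lowering the slope by `θ` costs at most the
value of the corresponding exponential at the edge of the window. -/
lemma exp_mul_le_indicator_add (hθ : 0 ≤ θ) (lam c r x : ℝ) :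
    Real.exp (lam * x) ≤
      {x | |x - c| ≤ r}.indicator (fun _ => Real.exp (lam * c + |lam| * r)) x +
      (Real.exp (-θ * (c + r)) * Real.exp ((lam + θ) * x) +
        Real.exp (θ * (c - r)) * Real.exp ((lam - θ) * x)) := by
  rw [← Real.exp_add, ← Real.exp_add]
  by_cases hx : |x - c| ≤ r
  · rw [Set.indicator_of_mem (by exact hx)]
    have hslope : lam * (x - c) ≤ |lam| * r := by
      refine (le_abs_self _).trans ?_
      rw [abs_mul]
      rel [hx]
    refine le_add_of_le_of_nonneg (Real.exp_le_exp.2 ?_) (by positivity)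
    linarith
  · rw [Set.indicator_of_notMem (by exact hx), zero_add]
    rcases lt_abs.1 (not_le.1 hx) with h | h
    · refine le_add_of_le_of_nonneg (Real.exp_le_exp.2 ?_) (by positivity)
      linarith [mul_le_mul_of_nonneg_left h.le hθ]
    · refine le_add_of_nonneg_of_le (by positivity) (Real.exp_le_exp.2 ?_)
      linarith [mul_le_mul_of_nonneg_left h.le hθ]

lemma prod_tilt_zero_le_indicator_add (hL : 0 ≤ L) (hθ : 0 ≤ θ) (η lam c r : ℝ) (ω : Ω) :
    ∏ i ∈ Finset.range N, tilt α η 0 L lam (X i ω) ≤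
      (bulkEvent X α c r L N).indicator (fun _ => Real.exp (lam * c + |lam| * r)) ω +
      (Real.exp (-θ * (c + r)) * ∏ i ∈ Finset.range N, tilt α η 0 L (lam + θ) (X i ω) +
        Real.exp (θ * (c - r)) * ∏ i ∈ Finset.range N, tilt α η 0 L (lam - θ) (X i ω)) := by
  rcases le_or_gt (partialMax X N ω : ℝ) L with hω | hω
  · simp only [prod_tilt_of_partialMax_le hω]
    refine (exp_mul_le_indicator_add hθ lam c r _).trans_eq (congrArg (· + _) ?_)
    simp only [Set.indicator, bulkEvent, Set.mem_ofPred_eq, hω, and_true]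
  · simp only [prod_tilt_zero_of_lt_partialMax hL hω, mul_zero, add_zero]
    exact Set.indicator_nonneg (fun _ _ => (Real.exp_pos _).le) ω

variable [MeasurableSpace Ω] {P : Measure Ω}

lemma IsIIDStretchedExp.measurableSet_bulkEvent (hX : IsIIDStretchedExp P α X) (c r L : ℝ)
    (N : ℕ) : MeasurableSet (bulkEvent X α c r L N) :=
  ((hX.measurable_partialSum N).prodMk (hX.measurable_partialMax N))
    (Set.to_countable
      {p : ℕ × ℕ | |(p.1 : ℝ) - mean α * N - c| ≤ r ∧ (p.2 : ℝ) ≤ L}).measurableSet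

lemma IsIIDStretchedExp.tiltMean_pow_le_bulkEvent_add [IsFiniteMeasure P] (hα : 0 < α)
    (hX : IsIIDStretchedExp P α X) (hη : 0 < η) (hη₁ : η ≤ 1) (hL : 0 ≤ L) (hθ : 0 ≤ θ)
    (lam c r : ℝ) (N : ℕ) :
    tiltMean α η 0 L lam ^ N ≤
      Real.exp (lam * c + |lam| * r) * P.real (bulkEvent X α c r L N) +
      (Real.exp (-θ * (c + r)) * tiltMean α η 0 L (lam + θ) ^ N +
        Real.exp (θ * (c - r)) * tiltMean α η 0 L (lam - θ) ^ N) := by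
  have hint (lam' : ℝ) := hX.integrable_prod_tilt hα hη hη₁ le_rfl L lam' (Finset.range N)
  have hmean (lam' : ℝ) := hX.integral_prod_tilt hα hη hη₁ le_rfl L lam' (Finset.range N)
  have hbulk := hX.measurableSet_bulkEvent c r L N
  have hind : Integrable ((bulkEvent X α c r L N).indicator
      fun _ => Real.exp (lam * c + |lam| * r)) P := (integrable_const _).indicator hbulk
  have hadd := ((hint (lam + θ)).const_mul (Real.exp (-θ * (c + r)))).add
    ((hint (lam - θ)).const_mul (Real.exp (θ * (c - r))))
  have hmono := integral_mono (hint lam) (hind.add hadd)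
    fun ω => prod_tilt_zero_le_indicator_add hL hθ η lam c r ω
  rw [integral_add' hind hadd, integral_add' ((hint _).const_mul _) ((hint _).const_mul _),
    integral_const_mul, integral_const_mul, integral_indicator_const _ hbulk, smul_eq_mul,
    mul_comm (P.real _)] at hmono
  simpa only [hmean, Finset.card_range] using hmono

lemma exp_neg_mul_le_of_le_exp {q a v κ M : ℝ} (hq : 0 ≤ q) (hκ : 4 * κ ≤ θ ^ 2 * v / 2)
    (hM : M ≤ Real.exp (q * ((a + θ) ^ 2 * v / 2 + κ))) :
    Real.exp (-(q * (θ * (a * v + θ * v)))) * M ≤ Real.exp (q * (a ^ 2 * v / 2 - 3 * κ)) := by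
  refine (mul_le_mul_of_nonneg_left hM (Real.exp_pos _).le).trans ?_
  rw [← Real.exp_add]
  refine Real.exp_le_exp.2 ?_
  linarith [mul_le_mul_of_nonneg_left hκ hq]

lemma exp_le_of_exp_le_add {q ℓ κ p e₁ e₂ : ℝ} (htwo : 2 ≤ Real.exp (q * κ))
    (he₁ : e₁ ≤ Real.exp (q * (ℓ - 3 * κ))) (he₂ : e₂ ≤ Real.exp (q * (ℓ - 3 * κ)))
    (h : Real.exp (q * (ℓ - κ)) ≤ p + (e₁ + e₂)) : Real.exp (q * (ℓ - 2 * κ)) ≤ p := by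
  have hdouble (x : ℝ) : 2 * Real.exp (q * (x - κ)) ≤ Real.exp (q * x) := by
    refine (mul_le_mul_of_nonneg_right htwo (Real.exp_pos _).le).trans_eq ?_
    rw [← Real.exp_add]
    ring_nf
  have h₁ := hdouble (ℓ - κ)
  have h₂ := hdouble (ℓ - 2 * κ)
  rw [show ℓ - κ - κ = ℓ - 2 * κ by ring] at h₁
  rw [show ℓ - 2 * κ - κ = ℓ - 3 * κ by ring] at h₂
  linarith

/-- Under the tilt with slope `a` the sum concentrates near `a σ²`; the tilts with slopes `a ± θ`
bound the contribution of the values outside of the window of radius `θ σ²`. -/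
lemma IsIIDStretchedExp.eventually_exp_le_measureReal_bulkEvent_slope [IsFiniteMeasure P]
    (hα₀ : 0 < α) (hα₁ : α < 1) (hX : IsIIDStretchedExp P α X) {N : ℕ → ℕ}
    (hN : Tendsto (fun n => (N n : ℝ) / n) atTop (𝓝 1)) {ε a κ : ℝ} (hε : 0 < ε)
    (ha : |a| * ε ^ (1 - α) ≤ 1 / 2) (hadd : |a + θ| * ε ^ (1 - α) ≤ 1 / 2)
    (hsub : |a - θ| * ε ^ (1 - α) ≤ 1 / 2) (hθ : 0 ≤ θ) (hκ : 0 < κ)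
    (hκθ : 4 * κ ≤ θ ^ 2 * var α / 2) :
    ∀ᶠ n : ℕ in atTop,
      Real.exp (-speed α n * (a ^ 2 * var α / 2 + |a| * (θ * var α) + 2 * κ)) ≤
        P.real (bulkEvent X α (a * var α * scale α n) (θ * var α * scale α n)
          (ε * scale α n) (N n)) := by
  have hpow {a' : ℝ} (ha' : |a'| * ε ^ (1 - α) ≤ 1 / 2) :=
    eventually_exp_le_tiltMean_pow_le_exp hα₀ hα₁ hε one_half_pos le_rfl le_rfl zero_le_one ha'
      hN hκ
  filter_upwards [hpow ha, hpow hadd, hpow hsub,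
    eventually_le_exp_speed_mul hα₀ (by linarith) hκ 2, eventually_gt_atTop 0]
    with n hpow hpowAdd hpowSub htwo hn
  have hscale : 0 < scale α n := scale_pos hn
  have hspeed : 0 < speed α n := speed_pos hn
  have hmean := hX.tiltMean_pow_le_bulkEvent_add hα₀ one_half_pos (by norm_num)
    (mul_nonneg hε.le hscale.le) (mul_nonneg hθ (div_nonneg hspeed.le hscale.le))
    (a * (speed α n / scale α n)) (a * var α * scale α n) (θ * var α * scale α n) (N n)
  rw [← add_mul a θ, ← sub_mul a θ] at hmean
  have herrAdd := exp_neg_mul_le_of_le_exp hspeed.le hκθ hpowAdd.2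
  have herrSub := exp_neg_mul_le_of_le_exp (a := -a) hspeed.le hκθ
    (hpowSub.2.trans_eq (by ring_nf))
  rw [neg_sq] at herrSub
  have hexpAdd : -(θ * (speed α n / scale α n)) * (a * var α * scale α n + θ * var α * scale α n) =
      -(speed α n * (θ * (a * var α + θ * var α))) := by field_simp
  have hexpSub : θ * (speed α n / scale α n) * (a * var α * scale α n - θ * var α * scale α n) =
      -(speed α n * (θ * (-a * var α + θ * var α))) := by field_simp; ring
  have hexpBulk : a * (speed α n / scale α n) * (a * var α * scale α n) +
      |a * (speed α n / scale α n)| * (θ * var α * scale α n) =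
      speed α n * (a ^ 2 * var α + |a| * (θ * var α)) := by
    rw [abs_mul, abs_of_pos (div_pos hspeed hscale)]
    field_simp
  rw [hexpAdd, hexpSub, hexpBulk] at hmean
  have hbulk := exp_le_of_exp_le_add htwo herrAdd herrSub (hpow.1.trans hmean)
  rw [← div_le_iff₀' (Real.exp_pos _), ← Real.exp_sub] at hbulk
  refine (Real.exp_le_exp.2 (le_of_eq ?_)).trans hbulk
  ring

lemma IsIIDStretchedExp.eventually_exp_le_measureReal_bulkEvent [IsFiniteMeasure P]
    (hα₀ : 0 < α) (hα₁ : α < 1) (hX : IsIIDStretchedExp P α X) {N : ℕ → ℕ}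
    (hN : Tendsto (fun n => (N n : ℝ) / n) atTop (𝓝 1)) (t : ℝ) {κ ε δ : ℝ} (hκ : 0 < κ)
    (hε : 0 < ε) (hδ : 0 < δ) :
    ∀ᶠ n : ℕ in atTop,
      Real.exp (-speed α n * (1 / (2 * var α) * t ^ 2 + |t| / var α * κ + δ)) ≤
        P.real (bulkEvent X α (t * scale α n) (κ * scale α n) (ε * scale α n) (N n)) := by
  have hv : 0 < var α := var_pos hα₀
  set a := t / var α
  set θ := κ / var α
  have hθ : 0 < θ := div_pos hκ hv
  have hsmall : ∀ᶠ ε' in 𝓝[>] (0 : ℝ), ε' ≤ ε := nhdsWithin_le_nhds (eventually_le_nhds hε)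
  obtain ⟨ε', hε', hle, ha, hadd, hsub⟩ := (eventually_mem_nhdsWithin.and
    (hsmall.and ((eventually_abs_mul_rpow_le_half hα₁ a).and
    ((eventually_abs_mul_rpow_le_half hα₁ (a + θ)).and
    (eventually_abs_mul_rpow_le_half hα₁ (a - θ)))))).exists
  set δ' := min (δ / 2) (θ ^ 2 * var α / 8)
  have hδ' : 0 < δ' := by positivity
  have hδ'θ : 4 * δ' ≤ θ ^ 2 * var α / 2 := by linarith [min_le_right (δ / 2) (θ ^ 2 * var α / 8)]
  filter_upwards [hX.eventually_exp_le_measureReal_bulkEvent_slope hα₀ hα₁ hN hε' ha hadd hsub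
    hθ.le hδ' hδ'θ, eventually_gt_atTop 0] with n hbulk hn
  rw [div_mul_cancel₀ t hv.ne', div_mul_cancel₀ κ hv.ne'] at hbulk
  refine le_trans (Real.exp_le_exp.2 ?_) (hbulk.trans (measureReal_mono (bulkEvent_mono
    (mul_le_mul_of_nonneg_right hle (scale_pos hn).le))))
  have hrate : a ^ 2 * var α / 2 = 1 / (2 * var α) * t ^ 2 := by
    simp only [a]
    field_simp
  have habs : |a| = |t| / var α := by rw [abs_div, abs_of_pos hv]
  rw [neg_mul, neg_mul, neg_le_neg_iff, hrate, habs]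
  refine mul_le_mul_of_nonneg_left ?_ (speed_pos hn).le
  linarith [min_le_left (δ / 2) (θ ^ 2 * var α / 8)]

end Bulk

/-! ### Prescribing the last variables given the first ones -/

section Prescribing

variable {Ω : Type*} [MeasurableSpace Ω] {P : Measure Ω}

lemma measure_preimage_mul_le_of_indepFun {β β' : Type*} [MeasurableSpace β]
    [MeasurableSingletonClass β] [Countable β] [MeasurableSpace β'] [MeasurableSingletonClass β']
    {Y : Ω → β} {Y' : Ω → β'} (hY : Measurable Y) (hind : IndepFun Y Y' P) {W : Set β}
    {g : β → β'} {Q : ℝ≥0∞} (hQ : ∀ y ∈ W, Q ≤ P (Y' ⁻¹' {g y})) :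
    P (Y ⁻¹' W) * Q ≤ P (Y ⁻¹' W ∩ {ω | Y' ω = g (Y ω)}) := by
  have hfiber (y : β) : MeasurableSet (Y ⁻¹' {y}) := hY (measurableSet_singleton y)
  rw [← Measure.restrict_apply (hY W.to_countable.measurableSet),
    ← tsum_measure_preimage_singleton W.to_countable fun y _ => hfiber y,
    ← tsum_measure_preimage_singleton W.to_countable fun y _ => hfiber y, ← ENNReal.tsum_mul_right]
  refine ENNReal.tsum_le_tsum fun y => ?_
  have hinter : Y ⁻¹' {(y : β)} ∩ {ω | Y' ω = g (Y ω)} = Y ⁻¹' {(y : β)} ∩ Y' ⁻¹' {g y} := by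
    ext ω
    exact and_congr_right fun hω : Y ω = y => by
      rw [Set.mem_ofPred_eq, hω, Set.mem_preimage, Set.mem_singleton_iff]
  rw [Measure.restrict_apply (hfiber y), hinter, hind.measure_inter_preimage_eq_mul _ _
    (measurableSet_singleton _) (measurableSet_singleton _)]
  exact mul_le_mul_right (hQ y y.2) _

variable {α : ℝ} {X : ℕ → Ω → ℕ}

lemma IsIIDStretchedExp.measure_forall_eq (hX : IsIIDStretchedExp P α X) (N k : ℕ) (ξ : ℕ → ℕ) :
    P ((fun ω (i : Fin k) => X (N + i) ω) ⁻¹' {fun i : Fin k => ξ i}) =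
      ∏ i ∈ Finset.range k, ENNReal.ofReal (weight α (ξ i)) := by
  have hinter := (hX.indep.precomp (add_right_injective N)).measure_inter_preimage_eq_mul
    (Finset.range k) (sets := fun i => {ξ i}) fun _ _ => measurableSet_singleton _
  refine (congrArg P ?_).trans (hinter.trans (Finset.prod_congr rfl fun i _ => hX.law (N + i) _))
  ext ω
  simp only [Set.mem_preimage, Set.mem_singleton_iff, funext_iff, Fin.forall_iff, Set.mem_iInter,
    Finset.mem_range]

lemma IsIIDStretchedExp.indepFun_partialSum_partialMax (hX : IsIIDStretchedExp P α X) (N k : ℕ) :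
    IndepFun (fun ω => (partialSum X N ω, partialMax X N ω))
      (fun ω (i : Fin k) => X (N + i) ω) P := by
  have hdisj : Disjoint (Finset.range N) (Finset.Ico N (N + k)) := by
    rw [Finset.range_eq_Ico]
    exact Finset.Ico_disjoint_Ico_consecutive 0 N (N + k)
  have hmem (i : Fin k) : N + i ∈ Finset.Ico N (N + k) := by
    rw [Finset.mem_Ico]
    omega
  let sumMax (z : Finset.range N → ℕ) : ℕ × ℕ := (∑ i, z i, Finset.univ.sup z)
  have hsumMax : (fun ω => (partialSum X N ω, partialMax X N ω)) =
      sumMax ∘ fun ω i => X i ω :=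
    funext fun ω => Prod.ext (Finset.sum_coe_sort (Finset.range N) fun i => X i ω).symm
      (Finset.sup_attach (Finset.range N) fun i => X i ω).symm
  rw [hsumMax]
  exact (hX.indep.indepFun_finset _ _ hdisj hX.measurable).comp (measurable_of_countable sumMax)
    (measurable_of_countable fun z (i : Fin k) => z ⟨N + i, hmem i⟩)

lemma IsIIDStretchedExp.measure_bulkEvent_mul_le (hX : IsIIDStretchedExp P α X) {c r L : ℝ}
    {N k : ℕ} {ξ : ℕ → ℕ → ℕ} {Q : ℝ≥0∞}
    (hQ : ∀ u : ℕ, |u - mean α * N - c| ≤ r →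
      Q ≤ ∏ i ∈ Finset.range k, ENNReal.ofReal (weight α (ξ u i))) :
    P (bulkEvent X α c r L N) * Q ≤
      P (bulkEvent X α c r L N ∩ {ω | ∀ i < k, X (N + i) ω = ξ (partialSum X N ω) i}) := by
  have hmul := measure_preimage_mul_le_of_indepFun
    ((hX.measurable_partialSum N).prodMk (hX.measurable_partialMax N))
    (hX.indepFun_partialSum_partialMax N k)
    (W := {p | |(p.1 : ℝ) - mean α * N - c| ≤ r ∧ (p.2 : ℝ) ≤ L})
    (g := fun p i => ξ p.1 i) fun p hp => (hQ p.1 hp.1).trans_eq (hX.measure_forall_eq N k _).symm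
  simp only [funext_iff, Fin.forall_iff] at hmul
  exact hmul

end Prescribing

/-! ### The lower bound -/

section LowerBound

variable {α κ ρ s t : ℝ} {x : ℕ → ℝ≥0} {n N K k u : ℕ}

lemma sum_floor_mem_Icc {ι : Type*} (B : Finset ι) {z : ι → ℝ} (hz : ∀ j ∈ B, 0 ≤ z j) :
    ((∑ j ∈ B, ⌊z j⌋₊ : ℕ) : ℝ) ∈ Set.Icc (∑ j ∈ B, z j - B.card) (∑ j ∈ B, z j) := by
  push_cast
  refine ⟨?_, Finset.sum_le_sum fun j hj => Nat.floor_le (hz j hj)⟩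
  rw [sub_le_iff_le_add, Finset.card_eq_sum_ones, Nat.cast_sum, ← Finset.sum_add_distrib]
  exact Finset.sum_le_sum fun j _ => by simpa using (Nat.lt_floor_add_one (z j)).le

/-- The values prescribed to the last `k + 2` variables, at scale `p`, when the preceding variables
add up to `u`: a correction, which makes the total equal to `K`, followed by the jumps
`⌊x_0 p⌋, …, ⌊x_k p⌋`. -/
def jumps (K k : ℕ) (p : ℝ) (x : ℕ → ℝ≥0) (u : ℕ) : ℕ → ℕ
  | 0 => K - u - ∑ j ∈ Finset.range (k + 1), ⌊x j * p⌋₊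
  | j + 1 => ⌊x j * p⌋₊

lemma add_sum_jumps {p : ℝ} (h : u + ∑ j ∈ Finset.range (k + 1), ⌊x j * p⌋₊ ≤ K) :
    u + ∑ i ∈ Finset.range (k + 2), jumps K k p x u i = K := by
  rw [Finset.sum_range_succ']
  simp only [jumps]
  omega

/-- Aiming the bulk at `2 κ p` below its target makes the correction nonnegative. -/
lemma correction_bounds {m p : ℝ} (hm : 0 ≤ m) (hp : 0 ≤ p)
    (hK : m * (N + (k + 2) : ℕ) + t * p = K) (ht : |t - s| ≤ κ / 2)
    (hbig : m * (k + 2) + (k + 1) ≤ κ / 2 * p)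
    (hu : |u - m * N - (s - ∑ j ∈ Finset.range (k + 1), (x j : ℝ) - 2 * κ) * p| ≤ κ * p) :
    u + ∑ j ∈ Finset.range (k + 1), ⌊x j * p⌋₊ ≤ K ∧ (jumps K k p x u 0 : ℝ) ≤ 4 * κ * p := by
  obtain ⟨hfloor, hfloor'⟩ := sum_floor_mem_Icc (Finset.range (k + 1))
    (z := fun j => x j * p) fun j _ => mul_nonneg (x j).coe_nonneg hp
  rw [← Finset.sum_mul] at hfloor hfloor'
  rw [Finset.card_range] at hfloor
  set D := ∑ j ∈ Finset.range (k + 1), ⌊x j * p⌋₊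
  push_cast at hfloor hK
  rw [abs_le] at hu ht
  have hlow := mul_le_mul_of_nonneg_right ht.1 hp
  have hupp := mul_le_mul_of_nonneg_right ht.2 hp
  have hmk : 0 ≤ m * (k + 2) := by positivity
  have hle : u + D ≤ K := by
    have : (u : ℝ) + D ≤ K := by linarith
    exact_mod_cast this
  refine ⟨hle, ?_⟩
  rw [jumps, Nat.sub_sub, Nat.cast_sub hle]
  push_cast
  linarith

lemma normConst_mul_exp_le_weight (hα : 0 < α) {z : ℝ} (hz : 0 ≤ z) {d : ℕ}
    (hd : d ≤ z * scale α n) : normConst α * Real.exp (-speed α n * z ^ α) ≤ weight α d := by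
  refine mul_le_mul_of_nonneg_left (Real.exp_le_exp.2 ?_) (normConst_pos hα).le
  have hscale : 0 ≤ scale α n := Real.rpow_nonneg n.cast_nonneg _
  have hpow := Real.rpow_le_rpow d.cast_nonneg hd hα.le
  rw [Real.mul_rpow hz hscale, ← speed_eq_scale_rpow] at hpow
  linarith

lemma le_prod_weight_jumps (hα : 0 < α) (hκ : 0 ≤ κ)
    (hcorr : (jumps K k (scale α n) x u 0 : ℝ) ≤ 4 * κ * scale α n) :
    normConst α ^ (k + 2) * Real.exp (-speed α n *
        (∑ j ∈ Finset.range (k + 1), (x j : ℝ) ^ α + (4 * κ) ^ α)) ≤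
      ∏ i ∈ Finset.range (k + 2), weight α (jumps K k (scale α n) x u i) := by
  have hc := normConst_pos hα
  have hscale : 0 ≤ scale α n := Real.rpow_nonneg n.cast_nonneg _
  rw [Finset.prod_range_succ']
  calc normConst α ^ (k + 2) * Real.exp (-speed α n *
        (∑ j ∈ Finset.range (k + 1), (x j : ℝ) ^ α + (4 * κ) ^ α))
      = (∏ j ∈ Finset.range (k + 1), (normConst α * Real.exp (-speed α n * (x j : ℝ) ^ α))) *
          (normConst α * Real.exp (-speed α n * (4 * κ) ^ α)) := by
        rw [Finset.prod_mul_distrib, Finset.prod_const, Finset.card_range, ← Real.exp_sum,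
          ← Finset.mul_sum, mul_add, Real.exp_add]
        ring
    _ ≤ _ := mul_le_mul (Finset.prod_le_prod (fun j _ => by positivity) fun j _ =>
          normConst_mul_exp_le_weight hα (x j).coe_nonneg
            (Nat.floor_le (mul_nonneg (x j).coe_nonneg hscale)))
        (normConst_mul_exp_le_weight hα (by positivity) hcorr) (by positivity)
        (Finset.prod_nonneg fun j _ => (weight_pos hα _).le)

section Deterministic

variable {Ω : Type*} {X : ℕ → Ω → ℕ} {ω : Ω}

lemma partialMax_add_le {b : ℝ} (hN : partialMax X N ω ≤ b) (hk : ∀ i < k, X (N + i) ω ≤ b) :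
    partialMax X (N + k) ω ≤ b := by
  have hb : 0 ≤ b := (Nat.cast_nonneg _).trans hN
  rw [← Nat.le_floor_iff hb] at hN ⊢
  refine Finset.sup_le fun i hi => ?_
  rcases lt_or_ge i N with hiN | hiN
  · exact (Finset.le_sup (f := fun i => X i ω) (Finset.mem_range.2 hiN)).trans hN
  · obtain ⟨j, rfl⟩ := Nat.exists_eq_add_of_le hiN
    exact Nat.le_floor (hk j (Nat.add_lt_add_iff_left.1 (Finset.mem_range.1 hi)))

lemma scaled_mem_ball {M : ℕ} {y : ℝ≥0} (hscale : 0 < scale α n) (hlow : y * scale α n - 1 ≤ M)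
    (hupp : M ≤ (y + ρ / 2) * scale α n) (hρ : 1 < ρ * scale α n) :
    scaled α n M ∈ Metric.ball y ρ := by
  rw [Metric.mem_ball, NNReal.dist_eq, abs_lt, coe_scaled, lt_sub_iff_add_lt, sub_lt_iff_lt_add,
    lt_div_iff₀ hscale, div_lt_iff₀ hscale]
  constructor <;> linarith

lemma mem_jointEvent_of_eq_jumps (hscale : 0 < scale α (N + (k + 2)))
    (hK : mean α * (N + (k + 2) : ℕ) + t * scale α (N + (k + 2)) = K) (hx : ∀ j, x j ≤ x 0)
    (hρ : 1 < ρ * scale α (N + (k + 2)))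
    (hmax : partialMax X N ω ≤ ρ / 2 * scale α (N + (k + 2)))
    (hle : partialSum X N ω + ∑ j ∈ Finset.range (k + 1), ⌊x j * scale α (N + (k + 2))⌋₊ ≤ K)
    (hcorr : jumps K k (scale α (N + (k + 2))) x (partialSum X N ω) 0 ≤
      ρ / 2 * scale α (N + (k + 2)))
    (heq : ∀ i < k + 2, X (N + i) ω = jumps K k (scale α (N + (k + 2))) x (partialSum X N ω) i) :
    ω ∈ jointEvent X α t (N + (k + 2)) (Metric.ball (x 0) ρ) := by
  set p := scale α (N + (k + 2))
  have hsum : partialSum X (N + (k + 2)) ω = K := by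
    rw [← add_sum_jumps hle, partialSum, Finset.sum_range_add]
    exact congrArg _ (Finset.sum_congr rfl fun i hi => heq i (Finset.mem_range.1 hi))
  have hx₀ : 0 ≤ x 0 * p := mul_nonneg (x 0).coe_nonneg hscale.le
  have hfirst : ⌊x 0 * p⌋₊ ≤ partialMax X (N + (k + 2)) ω := by
    have : X (N + 1) ω = ⌊x 0 * p⌋₊ := heq 1 (by omega)
    exact this ▸ Finset.le_sup (f := fun i => X i ω) (Finset.mem_range.2 (by omega))
  refine ⟨by rw [hsum, hK], scaled_mem_ball hscale ?_ (partialMax_add_le ?_ fun i hi => ?_) hρ⟩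
  · exact (Nat.sub_one_lt_floor _).le.trans (Nat.cast_le.2 hfirst)
  · linarith
  · rw [heq i hi]
    cases i with
    | zero => linarith
    | succ j =>
      have hfloor : (⌊x j * p⌋₊ : ℝ) ≤ x j * p := Nat.floor_le (by positivity)
      have hxj : x j * p ≤ x 0 * p := mul_le_mul_of_nonneg_right (hx j) hscale.le
      simp only [jumps]
      linarith [Nat.cast_nonneg (α := ℝ) (partialMax X N ω)]

end Deterministic

lemma tendsto_natCast_sub_div (k : ℕ) :
    Tendsto (fun n : ℕ => ((n - k : ℕ) : ℝ) / n) atTop (𝓝 1) := by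
  have hlim : Tendsto (fun n : ℕ => 1 - (k : ℝ) / n) atTop (𝓝 (1 - 0)) :=
    tendsto_const_nhds.sub (tendsto_const_div_atTop_nhds_zero_nat _)
  rw [sub_zero] at hlim
  refine hlim.congr' ?_
  filter_upwards [eventually_ge_atTop k, eventually_ne_atTop 0] with n hk hn
  rw [Nat.cast_sub hk, sub_div, div_self (Nat.cast_ne_zero.2 hn)]

lemma exists_correction_cost_lt {σ2 J : ℝ} {B : Finset ℕ} (hα : 0 < α)
    (hJ : finCost α σ2 s B x < J) (hρ : 0 < ρ) :
    ∃ κ > 0, 8 * κ ≤ ρ ∧ ∑ j ∈ B, (x j : ℝ) ^ α + (4 * κ) ^ α +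
      (1 / (2 * σ2) * (s - ∑ j ∈ B, (x j : ℝ) - 2 * κ) ^ 2 +
        |s - ∑ j ∈ B, (x j : ℝ) - 2 * κ| / σ2 * κ) < J := by
  set cost : ℝ → ℝ := fun κ => ∑ j ∈ B, (x j : ℝ) ^ α + (4 * κ) ^ α +
    (1 / (2 * σ2) * (s - ∑ j ∈ B, (x j : ℝ) - 2 * κ) ^ 2 +
      |s - ∑ j ∈ B, (x j : ℝ) - 2 * κ| / σ2 * κ)
  have hcont : Continuous cost := by
    have : Continuous fun κ : ℝ => (4 * κ) ^ α :=
      (continuous_const_mul 4).rpow_const fun _ => Or.inr hα.le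
    fun_prop
  have hcost₀ : cost 0 < J := by
    simpa only [cost, finCost, mul_zero, Real.zero_rpow hα.ne', add_zero, sub_zero] using hJ
  have hcost : ∀ᶠ κ in 𝓝[>] (0 : ℝ), cost κ < J :=
    nhdsWithin_le_nhds ((hcont.tendsto 0).eventually_lt_const hcost₀)
  have hsmall : ∀ᶠ κ in 𝓝[>] (0 : ℝ), κ ≤ ρ / 8 :=
    nhdsWithin_le_nhds (eventually_le_nhds (by positivity))
  obtain ⟨κ, hκ, hκρ, hκJ⟩ := (eventually_mem_nhdsWithin.and (hsmall.and hcost)).exists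
  exact ⟨κ, hκ, by linarith, hκJ⟩

lemma exp_le_mul_mul_exp {q a b c p δ : ℝ} (hc : 0 < c) (hp : Real.exp (-q * (b + δ)) ≤ p)
    (hcδ : c⁻¹ ≤ Real.exp (q * δ)) :
    Real.exp (-q * (a + b + 2 * δ)) ≤ p * (c * Real.exp (-q * a)) := by
  have hcδ' : Real.exp (-q * δ) ≤ c := by
    rw [neg_mul, Real.exp_neg]
    exact inv_le_of_inv_le₀ hc hcδ
  calc Real.exp (-q * (a + b + 2 * δ))
      = Real.exp (-q * (b + δ)) * (Real.exp (-q * δ) * Real.exp (-q * a)) := by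
        rw [← Real.exp_add, ← Real.exp_add]
        ring_nf
    _ ≤ p * (c * Real.exp (-q * a)) :=
        mul_le_mul hp (mul_le_mul_of_nonneg_right hcδ' (Real.exp_pos _).le) (by positivity)
          ((Real.exp_pos _).le.trans hp)

variable {Ω : Type*} [MeasurableSpace Ω] {P : Measure Ω} {X : ℕ → Ω → ℕ}

lemma IsIIDStretchedExp.mul_le_measure_jointEvent_ball (hα : 0 < α)
    (hX : IsIIDStretchedExp P α X) (hκ : 0 ≤ κ) (hκρ : 8 * κ ≤ ρ) (hx : ∀ j, x j ≤ x 0)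
    (hscale : 0 < scale α (N + (k + 2)))
    (hK : mean α * (N + (k + 2) : ℕ) + t * scale α (N + (k + 2)) = K) (ht : |t - s| ≤ κ / 2)
    (hbig : mean α * (k + 2) + (k + 1) ≤ κ / 2 * scale α (N + (k + 2)))
    (hρ : 1 < ρ * scale α (N + (k + 2))) :
    P (bulkEvent X α ((s - ∑ j ∈ Finset.range (k + 1), (x j : ℝ) - 2 * κ) * scale α (N + (k + 2)))
        (κ * scale α (N + (k + 2))) (ρ / 2 * scale α (N + (k + 2))) N) *
      ENNReal.ofReal (normConst α ^ (k + 2) * Real.exp (-speed α (N + (k + 2)) *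
        (∑ j ∈ Finset.range (k + 1), (x j : ℝ) ^ α + (4 * κ) ^ α))) ≤
      P (jointEvent X α t (N + (k + 2)) (Metric.ball (x 0) ρ)) := by
  have hbounds (u : ℕ) := correction_bounds (u := u) (x := x) (mean_nonneg hα) hscale.le hK ht hbig
  refine (hX.measure_bulkEvent_mul_le (k := k + 2)
    (ξ := jumps K k (scale α (N + (k + 2))) x) fun u hu => ?_).trans (measure_mono ?_)
  · rw [← ENNReal.ofReal_prod_of_nonneg fun i _ => (weight_pos hα _).le]
    exact ENNReal.ofReal_le_ofReal (le_prod_weight_jumps hα hκ (hbounds u hu).2)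
  · rintro ω ⟨⟨hsum, hmax⟩, heq⟩
    obtain ⟨hle, hcorr⟩ := hbounds _ hsum
    refine mem_jointEvent_of_eq_jumps hscale hK hx hρ hmax hle (hcorr.trans ?_) heq
    exact mul_le_mul_of_nonneg_right (by linarith) hscale.le

lemma IsIIDStretchedExp.eventually_exp_le_measure_jointEvent [IsFiniteMeasure P] (hα₀ : 0 < α)
    (hα₁ : α < 1) (hX : IsIIDStretchedExp P α X) {J : ℝ} {sn : ℕ → ℝ}
    (hsn : ∀ n : ℕ, 1 ≤ n → ∃ k : ℕ, mean α * n + sn n * scale α n = k)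
    (hs : Tendsto sn atTop (𝓝 s)) {O : Set ℝ≥0} (hO : IsOpen O) {y : ℝ≥0} (hy : y ∈ O)
    (hJ : f α (var α) s y < J) :
    ∀ᶠ n : ℕ in atTop, ENNReal.ofReal (Real.exp (-speed α n * J)) ≤
      P (jointEvent X α (sn n) n O) := by
  obtain ⟨x, k, hx, rfl, hcost⟩ := exists_finCost_lt (var_pos hα₀) hJ
  obtain ⟨ρ, hρ, hball⟩ := Metric.isOpen_iff.1 hO _ hy
  obtain ⟨κ, hκ, hκρ, hκJ⟩ := exists_correction_cost_lt hα₀ hcost hρ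
  set S := ∑ j ∈ Finset.range (k + 1), (x j : ℝ) ^ α
  set r := s - ∑ j ∈ Finset.range (k + 1), (x j : ℝ) - 2 * κ
  set δ := (J - (S + (4 * κ) ^ α + (1 / (2 * var α) * r ^ 2 + |r| / var α * κ))) / 2 with hδ
  have hδ₀ : 0 < δ := by linarith
  have hscale := tendsto_scale_atTop (hα₁.trans one_lt_two)
  filter_upwards [hX.eventually_exp_le_measureReal_bulkEvent hα₀ hα₁
      (tendsto_natCast_sub_div (k + 2)) r hκ (half_pos hρ) hδ₀,
    eventually_le_exp_speed_mul hα₀ (hα₁.trans one_lt_two) hδ₀ (normConst α ^ (k + 2))⁻¹,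
    (tendsto_iff_dist_tendsto_zero.1 hs).eventually_le_const (half_pos hκ),
    (hscale.const_mul_atTop (half_pos hκ)).eventually_ge_atTop (mean α * (k + 2) + (k + 1)),
    (hscale.const_mul_atTop hρ).eventually_gt_atTop 1, eventually_ge_atTop (k + 2)]
    with n hbulk hnorm hdist hbig hone hn
  obtain ⟨N, rfl⟩ := Nat.exists_eq_add_of_le' hn
  obtain ⟨K, hK⟩ := hsn (N + (k + 2)) (by omega)
  rw [Nat.add_sub_cancel] at hbulk
  refine le_trans ?_ ((hX.mul_le_measure_jointEvent_ball hα₀ hκ.le hκρ hx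
    (scale_pos (by omega)) hK hdist hbig hone).trans (measure_mono fun ω hω => ⟨hω.1, hball hω.2⟩))
  rw [← ofReal_measureReal, ← ENNReal.ofReal_mul measureReal_nonneg]
  refine ENNReal.ofReal_le_ofReal ?_
  convert exp_le_mul_mul_exp (pow_pos (normConst_pos hα₀) _) hbulk hnorm using 3
  rw [hδ]
  ring

end LowerBound

/-! ### Conditioning -/

section Conditioning

lemma log_div_le_of_le_exp {x : ℝ≥0∞} {q c : ℝ} (hq : 0 < q)
    (h : x ≤ ENNReal.ofReal (Real.exp (q * c))) : ENNReal.log x / (q : EReal) ≤ (c : EReal) := by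
  have hlog := ENNReal.log_le_log h
  rw [ENNReal.log_ofReal_of_pos (Real.exp_pos _), Real.log_exp] at hlog
  refine (EReal.div_le_div_right_of_nonneg (EReal.coe_nonneg.2 hq.le) hlog).trans_eq ?_
  rw [← EReal.coe_div, mul_div_cancel_left₀ _ hq.ne']

lemma le_log_div_of_exp_le {x : ℝ≥0∞} {q c : ℝ} (hq : 0 < q)
    (h : ENNReal.ofReal (Real.exp (q * c)) ≤ x) : (c : EReal) ≤ ENNReal.log x / (q : EReal) := by
  have hlog := ENNReal.log_le_log h
  rw [ENNReal.log_ofReal_of_pos (Real.exp_pos _), Real.log_exp] at hlog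
  refine le_of_eq_of_le ?_ (EReal.div_le_div_right_of_nonneg (EReal.coe_nonneg.2 hq.le) hlog)
  rw [← EReal.coe_div, mul_div_cancel_left₀ _ hq.ne']

lemma inv_ofReal_exp_mul_ofReal_exp (q a b : ℝ) :
    (ENNReal.ofReal (Real.exp (-q * b)))⁻¹ * ENNReal.ofReal (Real.exp (-q * a)) =
      ENNReal.ofReal (Real.exp (q * (b - a))) := by
  rw [← ENNReal.ofReal_inv_of_pos (Real.exp_pos _), ← Real.exp_neg,
    ← ENNReal.ofReal_mul (Real.exp_pos _).le, ← Real.exp_add]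
  ring_nf

variable {q : ℕ → ℝ} {x z : ℕ → ℝ≥0∞} {a b : ℝ}

lemma limsup_log_inv_mul_div_le (hq : ∀ᶠ n in atTop, 0 < q n)
    (hx : ∀ᶠ n in atTop, x n ≤ ENNReal.ofReal (Real.exp (-q n * a)))
    (hz : ∀ᶠ n in atTop, ENNReal.ofReal (Real.exp (-q n * b)) ≤ z n) :
    limsup (fun n => ENNReal.log ((z n)⁻¹ * x n) / (q n : EReal)) atTop ≤
      ((b - a : ℝ) : EReal) := by
  refine limsup_le_of_le (h := ?_)
  filter_upwards [hq, hx, hz] with n hqn hxn hzn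
  exact log_div_le_of_le_exp hqn ((mul_le_mul' (ENNReal.inv_le_inv.2 hzn) hxn).trans_eq
    (inv_ofReal_exp_mul_ofReal_exp _ _ _))

lemma le_liminf_log_inv_mul_div (hq : ∀ᶠ n in atTop, 0 < q n)
    (hx : ∀ᶠ n in atTop, ENNReal.ofReal (Real.exp (-q n * a)) ≤ x n)
    (hz : ∀ᶠ n in atTop, z n ≤ ENNReal.ofReal (Real.exp (-q n * b))) :
    ((b - a : ℝ) : EReal) ≤
      liminf (fun n => ENNReal.log ((z n)⁻¹ * x n) / (q n : EReal)) atTop := by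
  refine le_liminf_of_le (h := ?_)
  filter_upwards [hq, hx, hz] with n hqn hxn hzn
  exact le_log_div_of_exp_le hqn ((inv_ofReal_exp_mul_ofReal_exp _ _ _).symm.trans_le
    (mul_le_mul' (ENNReal.inv_le_inv.2 hzn) hxn))

lemma satisfiesLDP_inv_smul {E : Type*} [TopologicalSpace E] [MeasurableSpace E]
    {ν : ℕ → Measure E} {g : E → EReal} {I₀ : ℝ} (hI₀ : ⨅ y, g y = I₀)
    (hq : ∀ᶠ n in atTop, 0 < q n)
    (hupper : ∀ A, IsClosed A → ∀ a b : ℝ, a < b → (∀ y ∈ A, (b : EReal) ≤ g y) →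
      ∀ᶠ n in atTop, ν n A ≤ ENNReal.ofReal (Real.exp (-q n * a)))
    (hlower : ∀ O, IsOpen O → ∀ y ∈ O, ∀ a : ℝ, g y < a →
      ∀ᶠ n in atTop, ENNReal.ofReal (Real.exp (-q n * a)) ≤ ν n O) :
    SatisfiesLDP (fun n => (ν n Set.univ)⁻¹ • ν n) q (fun y => g y - ⨅ z, g z) := by
  rw [hI₀]
  constructor
  · intro A hA
    refine EReal.le_of_forall_lt_iff_le.1 fun c hc => ?_
    obtain ⟨b, hcb, hb⟩ := EReal.lt_iff_exists_real_btwn.1 (EReal.neg_lt_comm.1 hc)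
    have hcb : -c < b := EReal.coe_lt_coe_iff.1 hcb
    have hA' (y : E) (hy : y ∈ A) : ((b + I₀ : ℝ) : EReal) ≤ g y := by
      rw [EReal.coe_add, ← EReal.le_sub_iff_add_le (by simp) (by simp)]
      exact hb.le.trans (iInf₂_le y hy)
    obtain ⟨y, hy⟩ : ∃ y, g y < ((I₀ + (b + c) / 2 : ℝ) : EReal) := by
      rw [← iInf_lt_iff, hI₀, EReal.coe_lt_coe_iff]
      linarith
    refine (limsup_log_inv_mul_div_le hq (hupper A hA (b + I₀ - (b + c) / 2) _ (by linarith) hA')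
      (hlower _ isOpen_univ y (Set.mem_univ y) _ hy)).trans_eq ?_
    ring_nf
  · intro O hO
    refine EReal.ge_of_forall_gt_iff_ge.1 fun c hc => ?_
    have hlt := EReal.lt_neg_comm.1 hc
    simp only [iInf_lt_iff] at hlt
    obtain ⟨y, hy, hyc⟩ := hlt
    rw [EReal.sub_lt_iff (by simp) (by simp)] at hyc
    obtain ⟨b, hyb, hb⟩ := EReal.lt_iff_exists_real_btwn.1 hyc
    have hbc : b < -c + I₀ := by exact_mod_cast hb
    refine le_of_eq_of_le ?_ (le_liminf_log_inv_mul_div hq (hlower O hO y hy b hyb)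
      (hupper _ isClosed_univ (b + c) I₀ (by linarith) fun y _ => hI₀ ▸ iInf_le g y))
    ring_nf

variable {Ω : Type*} [MeasurableSpace Ω] {P : Measure Ω} {X : ℕ → Ω → ℕ} {α s : ℝ}

/-- The joint law of `S_n` and `M_n / n^γ`, restricted to `S_n = μ n + t n^γ` and seen as an
unnormalized law on `[0, ∞)`. -/
def jointLaw (P : Measure Ω) (X : ℕ → Ω → ℕ) (α t : ℝ) (n : ℕ) : Measure ℝ≥0 :=
  (P.restrict {ω | (partialSum X n ω : ℝ) = mean α * n + t * scale α n}).map
    fun ω => scaled α n (partialMax X n ω)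

lemma IsIIDStretchedExp.measurable_scaled_partialMax (hX : IsIIDStretchedExp P α X) (n : ℕ) :
    Measurable fun ω => scaled α n (partialMax X n ω) :=
  (measurable_of_countable (scaled α n)).comp (hX.measurable_partialMax n)

lemma IsIIDStretchedExp.jointLaw_apply (hX : IsIIDStretchedExp P α X) (t : ℝ) (n : ℕ)
    {A : Set ℝ≥0} (hA : MeasurableSet A) : jointLaw P X α t n A = P (jointEvent X α t n A) := by
  have hmax := hX.measurable_scaled_partialMax n
  rw [jointLaw, Measure.map_apply hmax hA, Measure.restrict_apply (hmax hA), Set.inter_comm]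
  rfl

lemma IsIIDStretchedExp.condMaxLaw_eq (hX : IsIIDStretchedExp P α X) (t : ℝ) (n : ℕ) :
    condMaxLaw P X (1 / (2 - α)) n (mean α * n + t * scale α n) =
      (jointLaw P X α t n Set.univ)⁻¹ • jointLaw P X α t n := by
  rw [hX.jointLaw_apply t n MeasurableSet.univ, jointLaw, ← Measure.map_smul]
  simp only [jointEvent, Set.mem_univ, and_true]
  rfl

lemma IsIIDStretchedExp.satisfiesLDP_condMaxLaw [IsFiniteMeasure P] (hα₀ : 0 < α) (hα₁ : α < 1)
    (hX : IsIIDStretchedExp P α X) {sn : ℕ → ℝ}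
    (hsn : ∀ n : ℕ, 1 ≤ n → ∃ k : ℕ, mean α * n + sn n * scale α n = k)
    (hs : Tendsto sn atTop (𝓝 s)) :
    SatisfiesLDP (fun n => condMaxLaw P X (1 / (2 - α)) n (mean α * n + sn n * scale α n))
      (speed α) (fun y => f α (var α) s y - ⨅ z, f α (var α) s z) := by
  obtain ⟨I₀, hI₀⟩ := exists_iInf_f_eq_coe hα₀ (var_pos hα₀) s
  simp only [hX.condMaxLaw_eq]
  refine satisfiesLDP_inv_smul hI₀
    ((tendsto_speed_atTop hα₀ (hα₁.trans one_lt_two)).eventually_gt_atTop 0) ?_ ?_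
  · intro A hA a b hab hb
    simp only [hX.jointLaw_apply _ _ hA.measurableSet]
    exact hX.eventually_measure_jointEvent_le hα₀ hα₁ hs hA hb hab
  · intro O hO y hy a hya
    simp only [hX.jointLaw_apply _ _ hO.measurableSet]
    exact hX.eventually_exp_le_measure_jointEvent hα₀ hα₁ hsn hs hO hy hya

end Conditioning

end StretchedExp

end

theorem theorem2p1 {Ω : Type*} [MeasurableSpace Ω] (P : Measure Ω) [IsProbabilityMeasure P]
    (α : ℝ) (hα₀ : 0 < α) (hα₁ : α < 1)
    (X : ℕ → Ω → ℕ) (hX : StretchedExp.IsIIDStretchedExp P α X)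
    (μ σ2 γ : ℝ)
    (hμ : μ = ∫ ω, (X 0 ω : ℝ) ∂P)
    (hσ2 : σ2 = ProbabilityTheory.variance (fun ω => (X 0 ω : ℝ)) P)
    (hγ : γ = 1 / (2 - α))
    (s : ℝ) (sn : ℕ → ℝ)
    (hsn : ∀ n : ℕ, 1 ≤ n → ∃ k : ℕ, μ * n + sn n * (n : ℝ) ^ γ = k)
    (hs : Tendsto sn atTop (𝓝 s)) :
    -- `f` is finite and satisfies the recursion, for every real parameter `r`
    (∀ (r : ℝ) (y : ℝ≥0), 0 ≤ StretchedExp.f α σ2 r y ∧ StretchedExp.f α σ2 r y < ⊤) ∧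
    (∀ (r : ℝ) (y : ℝ≥0), StretchedExp.f α σ2 r y =
      (((y : ℝ) ^ α : ℝ) : EReal) + ⨅ z ∈ Set.Icc 0 y, StretchedExp.f α σ2 (r - y) z) ∧
    StretchedExp.IsGoodRateFunction
      (fun y : ℝ≥0 => StretchedExp.f α σ2 s y - ⨅ z : ℝ≥0, StretchedExp.f α σ2 s z) ∧
    StretchedExp.SatisfiesLDP
      (fun n => StretchedExp.condMaxLaw P X γ n (μ * n + sn n * (n : ℝ) ^ γ))
      (fun n => (n : ℝ) ^ (γ * α))
      (fun y : ℝ≥0 => StretchedExp.f α σ2 s y - ⨅ z : ℝ≥0, StretchedExp.f α σ2 s z) := by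
  subst hγ
  obtain rfl : μ = StretchedExp.mean α := hμ.trans (hX.integral_eq_mean hα₀ 0)
  obtain rfl : σ2 = StretchedExp.var α := hσ2.trans (hX.variance_eq_var hα₀ 0)
  have hσ := StretchedExp.var_pos hα₀
  exact ⟨fun r y => ⟨StretchedExp.f_nonneg hσ r y, StretchedExp.f_lt_top hα₀ _ r y⟩,
    StretchedExp.f_eq_rpow_add_iInf, StretchedExp.isGoodRateFunction_f_sub hα₀ hα₁ hσ s,
    hX.satisfiesLDP_condMaxLaw hα₀ hα₁ hsn hs⟩
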